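/- Let $V$ be the universe of sets. For a set $M$, regarded as the structure $\langle M,\in\rangle$, let $P_{\mathrm{def}}(M)$ be the set of all $A\subseteq M$ that are first-order definable over $\langle M,\in\rangle$ with parameters from $M$. Call $A\subseteq M$ *implicitly definable over* $M$ if there are a first-order formula $\psi$ in the language $\{\in\}$ expanded by a unary predicate symbol, and parameters $\vec p$ from $M$, such that $A$ is the unique $B\subseteq M$ with $\langle M,\in,B\rangle\models\psi[\vec p]$. Let $P_{\mathrm{imp}}(M)$ be the set of all $A\subseteq M$ that are implicitly definable over $M$. The *implicitly constructible universe* $\mathrm{Imp}$ is obtained by iterating $P_{\mathrm{imp}}$ over the ordinals: $$\mathrm{Imp}_0=\emptyset,\qquad \mathrm{Imp}_{\alpha+1}=P_{\mathrm{imp}}(\mathrm{Imp}_\alpha),\qquad \mathrm{Imp}_\lambda=\bigcup_{\alpha<\lambda}\mathrm{Imp}_\alpha\ \text{ for limit }\lambda,\qquad \mathrm{Imp}=\bigcup_{\alpha}\mathrm{Imp}_\alpha .$$ Gödel's constructible universe $L=\bigcup_\alpha L_\alpha$ is obtained in the same way from $P_{\mathrm{def}}$. A set $a$ is *ordinal definable*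 if for some ordinal $\theta$ it is an element of $V_\theta$ that is definable in $\langle V_\theta,\in\rangle$ by a first-order formula with ordinal parameters below $\theta$; and $\mathrm{HOD}$ is the class of sets $a$ such that $a$ and all elements of its transitive closure are ordinal definable. **Theorem.** $\mathrm{Imp}$ is an inner model of $\mathrm{ZF}$, that is, a class (first-order definable in $\langle V,\in\rangle$, parameters allowed) which is transitive, contains all ordinals, and satisfies every axiom of $\mathrm{ZF}$. Moreover $$L\subseteq \mathrm{Imp}\subseteq \mathrm{HOD}.$$ -/

import Mathlib

universe u

noncomputable section

namespace ImpUniverse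

open FirstOrder FirstOrder.Language

/-! ### The language of set theory and its structures -/

/-- The relation symbols of the language of set theory: one binary symbol. -/
inductive SetRel : ℕ → Type
  | mem : SetRel 2

/-- The first-order language `{∈}` of set theory. -/
def setLang : FirstOrder.Language.{0, 0} := ⟨fun _ => Empty, SetRel⟩

/-- The membership symbol. -/
def memSym : setLang.Relations 2 := SetRel.mem

/-- The relation symbols of the language with a single unary predicate. -/
inductive PredRel : ℕ → Type
  | pred : PredRel 1

/-- The first-order language with a single unary predicate symbol. -/
def predLang : FirstOrder.Language.{0, 0} := ⟨fun _ => Empty, PredRel⟩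

/-- The language of set theory expanded by a unary predicate symbol. -/
abbrev setPredLang : FirstOrder.Language.{0, 0} := setLang.sum predLang

/-- The universe of sets `⟨V, ∈⟩`. -/
instance universeStructure : setLang.Structure ZFSet.{u} where
  funMap := fun f => Empty.elim f
  RelMap := fun r => match r with
    | SetRel.mem => fun v => v 0 ∈ v 1

/-- A class of sets `S`, as the structure `⟨S, ∈⟩`. -/
instance memStructure (S : Set ZFSet.{u}) : setLang.Structure S where
  funMap := fun f => Empty.elim f
  RelMap := fun r => match r with
    | SetRel.mem => fun v => (v 0 : ZFSet.{u}) ∈ (v 1 : ZFSet.{u})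

/-- The interpretation of the unary predicate symbol by `A`. -/
@[reducible] def predStructure {X : Type*} (A : Set X) : predLang.Structure X where
  funMap := fun f => Empty.elim f
  RelMap := fun r => match r with
    | PredRel.pred => fun v => v 0 ∈ A

/-- The expanded structure `⟨S, ∈, A⟩`, for `A ⊆ S`. -/
@[reducible] def expansion (S : Set ZFSet.{u}) (A : Set S) : setPredLang.Structure S :=
  letI := predStructure A
  inferInstance

/-! ### Definable and implicitly definable power sets -/

/-- `⟨S, ∈, A⟩ ⊨ ψ(p)`. -/
def ExpansionSat (S : Set ZFSet.{u}) (A : Set S) {n : ℕ} (ψ : setPredLang.Formula (Fin n))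
    (p : Fin n → S) : Prop :=
  letI := expansion S A
  ψ.Realize p

/-- `A ⊆ S` is implicitly definable over `⟨S, ∈⟩`: for some first-order formula in the language
expanded by a predicate symbol, and some parameters from `S`, the class `A` is the one and only
subclass of `S` for which the formula holds in the expanded structure. -/
def ImplicitlyDefinable (S : Set ZFSet.{u}) (A : Set S) : Prop :=
  ∃ (n : ℕ) (ψ : setPredLang.Formula (Fin n)) (p : Fin n → S),
    ∀ B : Set S, ExpansionSat S B ψ p ↔ B = A

/-- The set `A` as a subset of the domain of the structure `⟨M, ∈⟩`. -/
def trace (M A : ZFSet.{u}) : Set (M : Set ZFSet.{u}) := {y | (y : ZFSet.{u}) ∈ A}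

/-- `P_def(M)`: the subsets of `M` definable over `⟨M, ∈⟩`, parameters from `M` allowed. -/
def defPowerset (M : ZFSet.{u}) : ZFSet.{u} :=
  M.powerset.sep fun A => Set.univ.Definable₁ setLang (trace M A)

/-- `P_imp(M)`: the subsets of `M` implicitly definable over `⟨M, ∈⟩`, parameters from `M`
allowed. -/
def impPowerset (M : ZFSet.{u}) : ZFSet.{u} :=
  M.powerset.sep fun A => ImplicitlyDefinable (M : Set ZFSet.{u}) (trace M A)

/-! ### The three classes -/

/-- The transfinite iteration of an operation `P` on sets, from the empty set:
`H 0 = ∅`, `H (α + 1) = P (H α)`, and `H λ = ⋃ α < λ, H α` for limit `λ`. -/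
def hierarchy (P : ZFSet.{u} → ZFSet.{u}) (α : Ordinal.{u}) : ZFSet.{u} :=
  Ordinal.limitRecOn α ∅ (fun _ H => P H)
    (fun l _ H => ZFSet.iUnion fun b : Set.Iio l => H b.1 b.2)

/-- Gödel's constructible universe `L`. -/
def constructible : Set ZFSet.{u} := {x | ∃ α, x ∈ hierarchy defPowerset α}

/-- The implicitly constructible universe `Imp`. -/
def Imp : Set ZFSet.{u} := {x | ∃ α, x ∈ hierarchy impPowerset α}

/-- `x` is ordinal definable: for some ordinal `θ`, it is an element of `V_θ` that is definable in
`⟨V_θ, ∈⟩` by a first-order formula with ordinal parameters below `θ`. -/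
def OrdinalDefinable (x : ZFSet.{u}) : Prop :=
  ∃ (θ : Ordinal.{u}) (a : (ZFSet.vonNeumann θ : Set ZFSet.{u})), (a : ZFSet.{u}) = x ∧
    {y : (ZFSet.vonNeumann θ : Set ZFSet.{u}) | (y : ZFSet.{u}) ∈ θ.toZFSet}.Definable₁
      setLang {a}

/-- The class `HOD` of hereditarily ordinal definable sets. -/
def HOD : Set ZFSet.{u} := {x | x.Hereditarily OrdinalDefinable}

/-! ### The theory ZF -/

/-- The atomic formula `xᵢ ∈ xⱼ`. -/
def memF (m : ℕ) (i j : Fin m) : setLang.BoundedFormula Empty m :=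
  memSym.boundedFormula₂ (&i) (&j)

/-- The atomic formula `xᵢ = xⱼ`. -/
def eqF (m : ℕ) (i j : Fin m) : setLang.BoundedFormula Empty m :=
  (&i : setLang.Term (Empty ⊕ Fin m)) =' &j

/-- The formula `φ(x_{v 0}, x_{v 1}, …)`. -/
def substF {k m : ℕ} (φ : setLang.Formula (Fin k)) (v : Fin k → Fin m) :
    setLang.BoundedFormula Empty m :=
  BoundedFormula.relabel (k := 0) (fun i => (Sum.inr (v i) : Empty ⊕ Fin m)) φ

/-- Two sets with the same elements are equal. -/
def extensionality : setLang.Sentence :=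
  ∀' ∀' ((∀' (memF 3 2 0 ⇔ memF 3 2 1)) ⟹ eqF 2 0 1)

/-- Every nonempty set has an element disjoint from it. -/
def foundation : setLang.Sentence :=
  ∀' ((∃' memF 2 1 0) ⟹
    ∃' (memF 2 1 0 ⊓ ∼ (∃' (memF 3 2 1 ⊓ memF 3 2 0))))

/-- `{x₀, x₁}` exists. -/
def pairing : setLang.Sentence :=
  ∀' ∀' ∃' ∀' (memF 4 3 2 ⇔ (eqF 4 3 0 ⊔ eqF 4 3 1))

/-- `⋃ x₀` exists. -/
def union : setLang.Sentence :=
  ∀' ∃' ∀' (memF 3 2 1 ⇔ ∃' (memF 4 3 0 ⊓ memF 4 2 3))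

/-- The set of all subsets of `x₀` exists. -/
def powerSet : setLang.Sentence :=
  ∀' ∃' ∀' (memF 3 2 1 ⇔ ∀' (memF 4 3 2 ⟹ memF 4 3 0))

/-- There is a set that has the empty set as an element and is closed under `x ↦ x ∪ {x}`. -/
def infinity : setLang.Sentence :=
  ∃' ((∃' (memF 2 1 0 ⊓ ∀' ∼ (memF 3 2 1))) ⊓
    ∀' (memF 2 1 0 ⟹
      ∃' (memF 3 2 0 ⊓ ∀' (memF 4 3 2 ⇔ (memF 4 3 1 ⊔ eqF 4 3 1)))))

/-- The instance of separation for `φ(p₀, …, pₙ₋₁, x)`: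
`∀ p ∀ a ∃ b ∀ x (x ∈ b ↔ x ∈ a ∧ φ(p, x))`.
Here `a`, `b`, `x` are the variables with the numbers `n`, `n + 1`, `n + 2`. -/
def separation {n : ℕ} (φ : setLang.Formula (Fin (n + 1))) : setLang.Sentence :=
  BoundedFormula.alls (n := n) <|
    ∀' ∃' ∀' (memF (n + 3) (Fin.natAdd n 2) (Fin.natAdd n 1) ⇔
      (memF (n + 3) (Fin.natAdd n 2) (Fin.natAdd n 0) ⊓
        substF φ (Fin.snoc (α := fun _ => Fin (n + 3)) (Fin.castAdd 3) (Fin.natAdd n 2))))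

/-- The formula `φ(p₀, …, pₙ₋₁, xᵢ, xⱼ)`, where the `p` are the first `n` variables. -/
def substF₂ {n r : ℕ} (φ : setLang.Formula (Fin (n + 2))) (i j : Fin (n + r)) :
    setLang.BoundedFormula Empty (n + r) :=
  substF φ (Fin.snoc (α := fun _ => Fin (n + r))
    (Fin.snoc (α := fun _ => Fin (n + r)) (Fin.castAdd r) i) j)

/-- The instance of replacement for `φ(p₀, …, pₙ₋₁, x, y)`:
`∀ p ∀ a (∀ x ∀ y ∀ z (x ∈ a ∧ φ(p, x, y) ∧ φ(p, x, z) → y = z) →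
  ∃ b ∀ y (y ∈ b ↔ ∃ x (x ∈ a ∧ φ(p, x, y))))`.
Here `a` has the number `n`; then come `x`, `y`, `z` in the premise and `b`, `y`, `x` in the
conclusion. -/
def replacement {n : ℕ} (φ : setLang.Formula (Fin (n + 2))) : setLang.Sentence :=
  BoundedFormula.alls (n := n) <|
    ∀' ((∀' ∀' ∀' ((memF (n + 4) (Fin.natAdd n 1) (Fin.natAdd n 0) ⊓
            (substF₂ (r := 4) φ (Fin.natAdd n 1) (Fin.natAdd n 2) ⊓
              substF₂ (r := 4) φ (Fin.natAdd n 1) (Fin.natAdd n 3))) ⟹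
          eqF (n + 4) (Fin.natAdd n 2) (Fin.natAdd n 3))) ⟹
      ∃' ∀' (memF (n + 3) (Fin.natAdd n 2) (Fin.natAdd n 1) ⇔
        ∃' (memF (n + 4) (Fin.natAdd n 3) (Fin.natAdd n 0) ⊓
          substF₂ (r := 4) φ (Fin.natAdd n 3) (Fin.natAdd n 2))))

/-- Zermelo–Fraenkel set theory. -/
def ZF : setLang.Theory :=
  {extensionality, foundation, pairing, union, powerSet, infinity} ∪
    {σ | ∃ (n : ℕ) (φ : setLang.Formula (Fin (n + 1))), σ = separation φ} ∪
    {σ | ∃ (n : ℕ) (φ : setLang.Formula (Fin (n + 2))), σ = replacement φ}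

/-! ### Inner models -/

/-- `C` is an inner model of ZF: a class, that is, a collection of sets first-order definable with
parameters in `⟨V, ∈⟩`, which is transitive, contains all ordinals, and satisfies ZF. -/
structure IsInnerModelZF (C : Set ZFSet.{u}) : Prop where
  definable : Set.univ.Definable₁ setLang C
  transitive : ∀ x ∈ C, ∀ y ∈ x, y ∈ C
  ordinals : ∀ x : ZFSet.{u}, x.IsOrdinal → x ∈ C
  models : C ⊨ ZF

end ImpUniverse

end

/-! The proof isolates one property of a class `C`, `DefinablyClosed`: `C` is transitive and
contains every set that is a subset of `C` and definable over `⟨C, ∈⟩` with parameters. Such a class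
contains all ordinals, since the least missing one would be the definable class of all ordinals of
`C`. It also satisfies ZF (`DefinablyClosed.models_ZF`): union, power set, separation and
replacement each ask for a definable subclass of `C` that is bounded by a set of `V`, and such a
subclass is an element of `C`.

`Imp` is definably closed by reflection. Satisfaction in a class is available for all formulas at
once, so the Löwenheim–Skolem closure argument yields arbitrarily high levels that are fully
elementary in `Imp` (`exists_elementary_level`). A set definable over `Imp` is therefore definable
over some level that includes it. Since an explicit definition is also an implicit one
(`defPowerset_subset_impPowerset`), the set belongs to the next level.

For `L ⊆ Imp`, the hierarchy `L_α` is computed inside `Imp`. Recursion on membership can be carried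
out in any definably closed class (`DfnFun.iterate`), and the true `P_def` is a definable function
there (`DfnFun.defPowerset`). So each `L_α` is an element of `Imp`, and transitivity finishes. To
speak of formulas inside `C`, they are replaced by the relations they define on a set of
ω-sequences: `family` is the closure of the atomic relations under implication and projection, and
it represents exactly the definable relations. Coordinate 0 is set aside for the value of the unary
predicate, so the same family serves `P_imp`.

For definability of `Imp` and for `Imp ⊆ HOD`, the same analysis is applied with `C = V`. There
`P_imp` is a definable function, hence so is `α ↦ Imp_α`. By induction on `α`, each element of
`Imp_α` is definable in `V` from ordinals: it is the only solution of a condition whose parameters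
come from earlier levels. Reflection to some `V_θ` turns this into ordinal definability. -/

noncomputable section

namespace ImpUniverse

open FirstOrder FirstOrder.Language

/-! ### Uniform definability over a family of structures -/

section UniformlyDefinable

variable {L : FirstOrder.Language.{0, 0}} {X : Type*} {T : Type*} {ι : Type*} {κ : Type*}

/-- One formula defines the relation `P t` in the structure `str t`, for all `t` at once. -/
def UniformlyDefinable (L : FirstOrder.Language.{0, 0}) {X T ι : Type*}
    (str : T → L.Structure X) (P : T → (ι → X) → Prop) : Prop :=
  ∃ φ : L.Formula ι, ∀ t v, (letI := str t; φ.Realize v) ↔ P t v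

variable {str : T → L.Structure X}

namespace UniformlyDefinable

theorem congr {P Q : T → (ι → X) → Prop} (h : UniformlyDefinable L str P)
    (e : ∀ t v, P t v ↔ Q t v) : UniformlyDefinable L str Q :=
  let ⟨φ, hφ⟩ := h
  ⟨φ, fun t v => (hφ t v).trans (e t v)⟩

theorem falsum : UniformlyDefinable L str (fun _ (_ : ι → X) => False) :=
  ⟨⊥, fun _ _ => Iff.rfl⟩

theorem eq (i j : ι) : UniformlyDefinable L str (fun _ (v : ι → X) => v i = v j) :=
  ⟨Term.equal (Term.var i) (Term.var j), fun t v => by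
    let := str t
    simp [Formula.realize_equal]⟩

theorem imp {P Q : T → (ι → X) → Prop} (hP : UniformlyDefinable L str P)
    (hQ : UniformlyDefinable L str Q) :
    UniformlyDefinable L str (fun t v => P t v → Q t v) := by
  obtain ⟨φ, hφ⟩ := hP
  obtain ⟨ψ, hψ⟩ := hQ
  refine ⟨φ.imp ψ, fun t v => ?_⟩
  let := str t
  exact Formula.realize_imp.trans (imp_congr (hφ t v) (hψ t v))

theorem not {P : T → (ι → X) → Prop} (hP : UniformlyDefinable L str P) :
    UniformlyDefinable L str (fun t v => ¬ P t v) :=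
  hP.imp falsum

theorem and {P Q : T → (ι → X) → Prop} (hP : UniformlyDefinable L str P)
    (hQ : UniformlyDefinable L str Q) :
    UniformlyDefinable L str (fun t v => P t v ∧ Q t v) :=
  (hP.imp hQ.not).not.congr fun _ _ => by tauto

theorem iff {P Q : T → (ι → X) → Prop} (hP : UniformlyDefinable L str P)
    (hQ : UniformlyDefinable L str Q) :
    UniformlyDefinable L str (fun t v => P t v ↔ Q t v) :=
  ((hP.imp hQ).and (hQ.imp hP)).congr fun _ _ => by tauto

theorem relabel {P : T → (ι → X) → Prop} (hP : UniformlyDefinable L str P) (g : ι → κ) :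
    UniformlyDefinable L str (fun t (v : κ → X) => P t (fun i => v (g i))) := by
  obtain ⟨φ, hφ⟩ := hP
  refine ⟨φ.relabel g, fun t v => ?_⟩
  let := str t
  exact Formula.realize_relabel.trans (hφ t _)

/-- Variables are added one at a time by passing from `ι` to `Option ι`: `none` is the variable
being bound, and `some` reaches the older ones. All later definability proofs use this indexing. -/
theorem all {P : T → (ι → X) → X → Prop}
    (hP : UniformlyDefinable L str
      (fun t (w : Option ι → X) => P t (fun i => w (some i)) (w none))) :
    UniformlyDefinable L str (fun t (v : ι → X) => ∀ x, P t v x) := by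
  obtain ⟨φ, hφ⟩ := hP
  refine ⟨(BoundedFormula.relabel (n := 1) (k := 0)
    (fun o : Option ι => o.elim (Sum.inr 0) Sum.inl) φ).all, fun t v => ?_⟩
  let := str t
  refine BoundedFormula.realize_all.trans (forall_congr' fun x => ?_)
  refine BoundedFormula.realize_relabel.trans ?_
  have := hφ t (fun o => o.elim x v)
  refine Iff.trans ?_ this
  rw [Formula.Realize, iff_eq_eq]
  congr 1
  · funext o
    cases o <;> simp [Fin.snoc]
  · exact Subsingleton.elim _ _

theorem ex {P : T → (ι → X) → X → Prop}
    (hP : UniformlyDefinable L str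
      (fun t (w : Option ι → X) => P t (fun i => w (some i)) (w none))) :
    UniformlyDefinable L str (fun t (v : ι → X) => ∃ x, P t v x) :=
  (all (P := fun t v x => ¬ P t v x) hP.not).not.congr fun _ _ => by simp

theorem forall_fin {n : ℕ} {P : Fin n → T → (ι → X) → Prop}
    (hP : ∀ i, UniformlyDefinable L str (P i)) :
    UniformlyDefinable L str (fun t v => ∀ i, P i t v) := by
  induction n with
  | zero => exact (falsum.imp falsum).congr fun _ _ => by simp
  | succ n ih =>
    exact ((hP 0).and (ih fun i => hP i.succ)).congr fun _ _ => by
      rw [Fin.forall_fin_succ]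

end UniformlyDefinable

end UniformlyDefinable

/-! ### Definable relations and functions of a class -/

section Dfn

variable {C : Set ZFSet.{u}} {ι : Type*} {κ : Type*}

/-- The relation `P` is first-order definable without parameters in `⟨C, ∈⟩`. -/
def Dfn (C : Set ZFSet.{u}) {ι : Type*} (P : (ι → C) → Prop) : Prop :=
  ∃ φ : setLang.Formula ι, ∀ v, φ.Realize v ↔ P v

/-- Definability over one structure is the case of a one-member family, so the closure rules proved
above carry over. -/
theorem dfn_iff_uniformlyDefinable {P : (ι → C) → Prop} :
    Dfn C P ↔ UniformlyDefinable setLang (fun _ : Unit => memStructure C) (fun _ => P) :=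
  ⟨fun ⟨φ, h⟩ => ⟨φ, fun _ v => h v⟩, fun ⟨φ, h⟩ => ⟨φ, fun v => h () v⟩⟩

namespace Dfn

theorem congr {P Q : (ι → C) → Prop} (h : Dfn C P) (e : ∀ v, P v ↔ Q v) : Dfn C Q :=
  let ⟨φ, hφ⟩ := h
  ⟨φ, fun v => (hφ v).trans (e v)⟩

theorem not {P : (ι → C) → Prop} (hP : Dfn C P) : Dfn C (fun v => ¬ P v) :=
  dfn_iff_uniformlyDefinable.2 (dfn_iff_uniformlyDefinable.1 hP).not

theorem imp {P Q : (ι → C) → Prop} (hP : Dfn C P) (hQ : Dfn C Q) : Dfn C (fun v => P v → Q v) :=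
  dfn_iff_uniformlyDefinable.2
    ((dfn_iff_uniformlyDefinable.1 hP).imp (dfn_iff_uniformlyDefinable.1 hQ))

theorem and {P Q : (ι → C) → Prop} (hP : Dfn C P) (hQ : Dfn C Q) : Dfn C (fun v => P v ∧ Q v) :=
  dfn_iff_uniformlyDefinable.2
    ((dfn_iff_uniformlyDefinable.1 hP).and (dfn_iff_uniformlyDefinable.1 hQ))

theorem iff {P Q : (ι → C) → Prop} (hP : Dfn C P) (hQ : Dfn C Q) : Dfn C (fun v => P v ↔ Q v) :=
  dfn_iff_uniformlyDefinable.2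
    ((dfn_iff_uniformlyDefinable.1 hP).iff (dfn_iff_uniformlyDefinable.1 hQ))

theorem or {P Q : (ι → C) → Prop} (hP : Dfn C P) (hQ : Dfn C Q) : Dfn C (fun v => P v ∨ Q v) :=
  (hP.not.imp hQ).congr fun _ => by tauto

theorem relabel {P : (ι → C) → Prop} (hP : Dfn C P) (g : ι → κ) :
    Dfn C (fun v : κ → C => P (fun i => v (g i))) :=
  dfn_iff_uniformlyDefinable.2 ((dfn_iff_uniformlyDefinable.1 hP).relabel g)

theorem forall_fin {n : ℕ} {P : Fin n → (ι → C) → Prop} (hP : ∀ i, Dfn C (P i)) :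
    Dfn C (fun v => ∀ i, P i v) :=
  dfn_iff_uniformlyDefinable.2
    (UniformlyDefinable.forall_fin fun i => dfn_iff_uniformlyDefinable.1 (hP i))

theorem all {P : (ι → C) → ZFSet.{u} → Prop}
    (hP : Dfn C (fun w : Option ι → C => P (fun i => w (some i)) (w none))) :
    Dfn C (fun v : ι → C => ∀ x ∈ C, P v x) :=
  (dfn_iff_uniformlyDefinable.2
    (UniformlyDefinable.all (P := fun _ v (x : C) => P v x)
      (dfn_iff_uniformlyDefinable.1 hP))).congr fun _ => by simp

theorem ex {P : (ι → C) → ZFSet.{u} → Prop}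
    (hP : Dfn C (fun w : Option ι → C => P (fun i => w (some i)) (w none))) :
    Dfn C (fun v : ι → C => ∃ x ∈ C, P v x) :=
  (dfn_iff_uniformlyDefinable.2
    (UniformlyDefinable.ex (P := fun _ v (x : C) => P v x)
      (dfn_iff_uniformlyDefinable.1 hP))).congr fun _ => by simp

theorem eq_var (i j : ι) : Dfn C (fun v : ι → C => (v i : ZFSet.{u}) = v j) :=
  (dfn_iff_uniformlyDefinable.2 (UniformlyDefinable.eq i j)).congr fun _ => Subtype.ext_iff

theorem mem_var (i j : ι) : Dfn C (fun v : ι → C => (v i : ZFSet.{u}) ∈ (v j : ZFSet.{u})) :=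
  ⟨memSym.formula₂ (Term.var i) (Term.var j), fun v => by
    rw [Formula.realize_rel₂]
    rfl⟩

end Dfn

/-- The function `f` has values in `C`, and its graph is definable without parameters in
`⟨C, ∈⟩`. -/
structure DfnFun (C : Set ZFSet.{u}) {ι : Type*} (f : (ι → C) → ZFSet.{u}) : Prop where
  mem : ∀ v, f v ∈ C
  graph : Dfn C (fun w : Option ι → C => (w none : ZFSet.{u}) = f (fun i => w (some i)))

/-- `P v (f v)` is rewritten as `∃ x, x = f v ∧ P v x`. The quantifier ranges over `C` only, which
is why `DfnFun` demands values in `C`. -/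
theorem Dfn.subst {f : (ι → C) → ZFSet.{u}} {P : (ι → C) → ZFSet.{u} → Prop} (hf : DfnFun C f)
    (hP : Dfn C (fun w : Option ι → C => P (fun i => w (some i)) (w none))) :
    Dfn C (fun v => P v (f v)) :=
  (Dfn.ex (P := fun v x => x = f v ∧ P v x) (hf.graph.and hP)).congr fun v =>
    ⟨fun ⟨_, _, h, h'⟩ => h ▸ h', fun h => ⟨_, hf.mem v, rfl, h⟩⟩

theorem DfnFun.var (i : ι) : DfnFun C (fun v : ι → C => (v i : ZFSet.{u})) :=
  ⟨fun v => (v i).2, Dfn.eq_var _ _⟩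

theorem DfnFun.congr {f g : (ι → C) → ZFSet.{u}} (hf : DfnFun C f) (e : ∀ v, f v = g v) :
    DfnFun C g :=
  (funext e : f = g) ▸ hf

theorem DfnFun.relabel {f : (ι → C) → ZFSet.{u}} (hf : DfnFun C f) (g : ι → κ) :
    DfnFun C (fun v : κ → C => f (fun i => v (g i))) :=
  ⟨fun _ => hf.mem _, (hf.graph.relabel (Option.map g)).congr fun _ => Iff.rfl⟩

theorem Dfn.comp₁ {R : ZFSet.{u} → Prop} (hR : Dfn C (fun v : Fin 1 → C => R (v 0)))
    {f : (ι → C) → ZFSet.{u}} (hf : DfnFun C f) : Dfn C (fun v => R (f v)) :=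
  Dfn.subst (P := fun _ x => R x) hf (hR.relabel fun _ => none)

theorem Dfn.comp₂ {R : ZFSet.{u} → ZFSet.{u} → Prop}
    (hR : Dfn C (fun v : Fin 2 → C => R (v 0) (v 1)))
    {f g : (ι → C) → ZFSet.{u}} (hf : DfnFun C f) (hg : DfnFun C g) :
    Dfn C (fun v => R (f v) (g v)) :=
  Dfn.subst (P := fun v x => R x (g v)) hf <|
    Dfn.subst (P := fun w y => R (w none) y) (hg.relabel some)
      (hR.relabel ![some none, none])

theorem Dfn.comp₃ {R : ZFSet.{u} → ZFSet.{u} → ZFSet.{u} → Prop}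
    (hR : Dfn C (fun v : Fin 3 → C => R (v 0) (v 1) (v 2)))
    {f g h : (ι → C) → ZFSet.{u}} (hf : DfnFun C f) (hg : DfnFun C g) (hh : DfnFun C h) :
    Dfn C (fun v => R (f v) (g v) (h v)) :=
  Dfn.subst (P := fun v x => R x (g v) (h v)) hf <|
    Dfn.subst (P := fun w y => R (w none) y (h fun i => w (some i))) (hg.relabel some) <|
      Dfn.subst (P := fun w z => R (w (some none)) (w none) z) (hh.relabel fun i => some (some i))
      (hR.relabel ![some (some none), some none, none])

theorem Dfn.comp₄ {R : ZFSet.{u} → ZFSet.{u} → ZFSet.{u} → ZFSet.{u} → Prop}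
    (hR : Dfn C (fun v : Fin 4 → C => R (v 0) (v 1) (v 2) (v 3)))
    {f g h k : (ι → C) → ZFSet.{u}} (hf : DfnFun C f) (hg : DfnFun C g) (hh : DfnFun C h)
    (hk : DfnFun C k) :
    Dfn C (fun v => R (f v) (g v) (h v) (k v)) :=
  Dfn.subst (P := fun v x => R x (g v) (h v) (k v)) hf <|
    Dfn.subst (P := fun w y => R (w none) y (h fun i => w (some i)) (k fun i => w (some i)))
      (hg.relabel some) <|
    Dfn.subst (P := fun w z => R (w (some none)) (w none) z (k fun i => w (some (some i))))
      (hh.relabel fun i => some (some i)) <|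
    Dfn.subst (P := fun w z => R (w (some (some none))) (w (some none)) (w none) z)
      (hk.relabel fun i => some (some (some i)))
      (hR.relabel ![some (some (some none)), some (some none), some none, none])

theorem DfnFun.comp₁ {F : ZFSet.{u} → ZFSet.{u}} (hF : DfnFun C (fun v : Fin 1 → C => F (v 0)))
    {f : (ι → C) → ZFSet.{u}} (hf : DfnFun C f) : DfnFun C (fun v => F (f v)) :=
  ⟨fun v => hF.mem fun _ => ⟨f v, hf.mem v⟩,
    Dfn.comp₂ (R := fun x y => x = F y) (hF.graph.relabel fun o => o.elim 0 fun _ => 1)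
      (.var _) (hf.relabel some)⟩

theorem DfnFun.comp₂ {F : ZFSet.{u} → ZFSet.{u} → ZFSet.{u}}
    (hF : DfnFun C (fun v : Fin 2 → C => F (v 0) (v 1)))
    {f g : (ι → C) → ZFSet.{u}} (hf : DfnFun C f) (hg : DfnFun C g) :
    DfnFun C (fun v => F (f v) (g v)) :=
  ⟨fun v => hF.mem ![⟨f v, hf.mem v⟩, ⟨g v, hg.mem v⟩],
    Dfn.comp₃ (R := fun x y z => x = F y z) (hF.graph.relabel fun o => o.elim 0 Fin.succ)
      (.var _) (hf.relabel some) (hg.relabel some)⟩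

theorem DfnFun.comp₃ {F : ZFSet.{u} → ZFSet.{u} → ZFSet.{u} → ZFSet.{u}}
    (hF : DfnFun C (fun v : Fin 3 → C => F (v 0) (v 1) (v 2)))
    {f g h : (ι → C) → ZFSet.{u}} (hf : DfnFun C f) (hg : DfnFun C g) (hh : DfnFun C h) :
    DfnFun C (fun v => F (f v) (g v) (h v)) :=
  ⟨fun v => hF.mem ![⟨f v, hf.mem v⟩, ⟨g v, hg.mem v⟩, ⟨h v, hh.mem v⟩],
    Dfn.comp₄ (R := fun x y z t => x = F y z t) (hF.graph.relabel fun o => o.elim 0 Fin.succ)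
      (.var _) (hf.relabel some) (hg.relabel some) (hh.relabel some)⟩

theorem Dfn.eq {f g : (ι → C) → ZFSet.{u}} (hf : DfnFun C f) (hg : DfnFun C g) :
    Dfn C (fun v => f v = g v) :=
  Dfn.comp₂ (R := fun x y => x = y) (Dfn.eq_var _ _) hf hg

theorem Dfn.mem {f g : (ι → C) → ZFSet.{u}} (hf : DfnFun C f) (hg : DfnFun C g) :
    Dfn C (fun v => f v ∈ g v) :=
  Dfn.comp₂ (R := fun x y => x ∈ y) (Dfn.mem_var _ _) hf hg

end Dfn

/-! ### Classes closed under definable subsets -/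

section DefinablyClosed

/-- A transitive class `C` that contains every set which is a subset of `C` and is definable with
parameters over `⟨C, ∈⟩`. -/
structure DefinablyClosed (C : Set ZFSet.{u}) : Prop where
  trans : ∀ x ∈ C, ∀ y ∈ x, y ∈ C
  compr : ∀ X : ZFSet.{u}, (∀ x ∈ X, x ∈ C) →
    Set.univ.Definable₁ setLang {y : C | (y : ZFSet.{u}) ∈ X} → X ∈ C

variable {C : Set ZFSet.{u}} {ι : Type*}

theorem definablyClosed_univ : DefinablyClosed (Set.univ : Set ZFSet.{u}) :=
  ⟨fun _ _ _ _ => trivial, fun _ _ _ => trivial⟩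

theorem definable₁_of_dfn {P : (ι → C) → C → Prop} {A : Set C}
    (h : Dfn C (fun w : Option ι → C => P (fun i => w (some i)) (w none))) (v : ι → C)
    (hv : ∀ i, v i ∈ A) : A.Definable₁ setLang {y : C | P v y} := by
  obtain ⟨φ, hφ⟩ := h
  refine Set.definable_iff_exists_formula_sum.2
    ⟨φ.relabel fun o => o.elim (Sum.inr 0) fun i => Sum.inl ⟨v i, hv i⟩, ?_⟩
  ext x
  simp only [Set.mem_ofPred_eq, Formula.realize_relabel, hφ]
  rfl

variable (hC : DefinablyClosed C)
include hC

theorem DefinablyClosed.mem_of_dfn {P : (ι → C) → ZFSet.{u} → Prop}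
    (hP : Dfn C (fun w : Option ι → C => P (fun i => w (some i)) (w none))) (v : ι → C)
    {X : ZFSet.{u}} (hX : ∀ x ∈ X, x ∈ C) (h : ∀ x ∈ C, x ∈ X ↔ P v x) : X ∈ C := by
  refine hC.compr X hX ?_
  convert definable₁_of_dfn (A := Set.univ) (P := fun v x => P v x) hP v
    fun _ => trivial using 1
  ext y
  exact h y y.2

/-- The main way to obtain definable functions: closure of `C` puts the value into `C`, and by
transitivity of `C` extensionality then defines the graph. Membership in the value is the true one,
so absoluteness is built in. -/
theorem DfnFun.of_mem {f : (ι → C) → ZFSet.{u}} (hsub : ∀ v, ∀ x ∈ f v, x ∈ C)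
    (h : Dfn C (fun w : Option ι → C => (w none : ZFSet.{u}) ∈ f (fun i => w (some i)))) :
    DfnFun C f where
  mem v := hC.mem_of_dfn (P := fun v x => x ∈ f v) h v (hsub v) fun _ _ => Iff.rfl
  graph := by
    refine (Dfn.all (P := fun w x => x ∈ (w none : ZFSet.{u}) ↔ x ∈ f (fun i => w (some i)))
      (Dfn.iff (.mem_var none (some none)) (h.relabel (Option.map some)))).congr fun w => ?_
    constructor
    · intro H
      ext x
      exact ⟨fun hx => (H x (hC.trans _ (w none).2 _ hx)).1 hx,
        fun hx => (H x (hsub _ _ hx)).2 hx⟩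
    · intro H x _
      rw [H]

theorem Dfn.bex {f : (ι → C) → ZFSet.{u}} {P : (ι → C) → ZFSet.{u} → Prop} (hf : DfnFun C f)
    (hP : Dfn C (fun w : Option ι → C => P (fun i => w (some i)) (w none))) :
    Dfn C (fun v => ∃ x ∈ f v, P v x) :=
  (Dfn.ex (P := fun v x => x ∈ f v ∧ P v x) ((Dfn.mem (.var none) (hf.relabel some)).and hP)).congr
    fun v => ⟨fun ⟨x, _, h⟩ => ⟨x, h⟩, fun ⟨x, h⟩ => ⟨x, hC.trans _ (hf.mem v) _ h.1, h⟩⟩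

theorem Dfn.ball {f : (ι → C) → ZFSet.{u}} {P : (ι → C) → ZFSet.{u} → Prop} (hf : DfnFun C f)
    (hP : Dfn C (fun w : Option ι → C => P (fun i => w (some i)) (w none))) :
    Dfn C (fun v => ∀ x ∈ f v, P v x) :=
  (Dfn.bex hC (P := fun v x => ¬ P v x) hf hP.not).not.congr fun v => by simp

theorem Dfn.subset {f g : (ι → C) → ZFSet.{u}} (hf : DfnFun C f) (hg : DfnFun C g) :
    Dfn C (fun v => f v ⊆ g v) :=
  Dfn.comp₂ (R := fun x y => x ⊆ y)
    ((Dfn.ball hC (.var 0) (Dfn.mem (.var none) (.var (some 1)))).congr fun _ => Iff.rfl) hf hg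

theorem DfnFun.empty : DfnFun C (fun _ : ι → C => ∅) :=
  .of_mem hC (fun _ x hx => absurd hx (ZFSet.notMem_empty x))
    ((Dfn.eq_var none none).not.congr fun _ => by simp)

theorem DfnFun.insert {f g : (ι → C) → ZFSet.{u}} (hf : DfnFun C f) (hg : DfnFun C g) :
    DfnFun C (fun v => insert (f v) (g v)) :=
  DfnFun.comp₂ (.of_mem hC
    (fun v x hx => (ZFSet.mem_insert_iff.1 hx).elim (fun h => h ▸ (v 0).2)
      fun h => hC.trans _ (v 1).2 _ h)
    (((Dfn.eq_var none (some 0)).or (.mem_var none (some 1))).congr fun _ => by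
      rw [ZFSet.mem_insert_iff])) hf hg

theorem DfnFun.singleton {f : (ι → C) → ZFSet.{u}} (hf : DfnFun C f) :
    DfnFun C (fun v => {f v}) :=
  (DfnFun.insert hC hf (.empty hC)).congr fun _ => by ext; simp

theorem DfnFun.pair {f g : (ι → C) → ZFSet.{u}} (hf : DfnFun C f) (hg : DfnFun C g) :
    DfnFun C (fun v => ZFSet.pair (f v) (g v)) :=
  .insert hC (.singleton hC hf) (.singleton hC (.insert hC hf (.singleton hC hg)))

theorem DfnFun.sUnion {f : (ι → C) → ZFSet.{u}} (hf : DfnFun C f) :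
    DfnFun C (fun v => ZFSet.sUnion (f v)) :=
  DfnFun.comp₁ (.of_mem hC
    (fun v _ hx => let ⟨y, hy, hx⟩ := ZFSet.mem_sUnion.1 hx
      hC.trans _ (hC.trans _ (v 0).2 y hy) _ hx)
    ((Dfn.bex hC (.var (some 0)) (.mem_var (some none) none)).congr fun _ => by
      rw [ZFSet.mem_sUnion])) hf

theorem DfnFun.sep {f : (ι → C) → ZFSet.{u}} {P : (ι → C) → ZFSet.{u} → Prop} (hf : DfnFun C f)
    (hP : Dfn C (fun w : Option ι → C => P (fun i => w (some i)) (w none))) :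
    DfnFun C (fun v => ZFSet.sep (P v) (f v)) :=
  .of_mem hC (fun v _ hx => hC.trans _ (hf.mem v) _ (ZFSet.mem_sep.1 hx).1)
    ((Dfn.and (.mem (.var none) (hf.relabel some)) hP).congr fun _ => by rw [ZFSet.mem_sep])

theorem Dfn.isTransitive {f : (ι → C) → ZFSet.{u}} (hf : DfnFun C f) :
    Dfn C (fun v => (f v).IsTransitive) :=
  Dfn.comp₁ (R := ZFSet.IsTransitive)
    (Dfn.ball hC (.var 0) (Dfn.subset hC (.var none) (.var (some 0)))) hf

theorem Dfn.isOrdinal {f : (ι → C) → ZFSet.{u}} (hf : DfnFun C f) :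
    Dfn C (fun v => (f v).IsOrdinal) :=
  Dfn.comp₁ (R := ZFSet.IsOrdinal)
    (((Dfn.isTransitive hC (.var 0)).and
      (.ball hC (.var 0) (Dfn.isTransitive hC (.var none)))).congr fun _ => by
        rw [ZFSet.isOrdinal_iff_forall_mem_isTransitive]) hf

/-- A least ordinal outside `C` would consist of exactly the ordinals of `C`, a class definable over
`C` without parameters, and closure would put it into `C`. -/
theorem DefinablyClosed.isOrdinal_mem {x : ZFSet.{u}} (hx : x.IsOrdinal) : x ∈ C := by
  induction x using ZFSet.inductionOn with
  | _ x ih =>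
  by_contra hxC
  have hsub : ∀ y ∈ x, y ∈ C := fun y hy => ih y hy (hx.mem hy)
  refine hxC ((DfnFun.of_mem (ι := Empty) hC (f := fun _ => x) (fun _ => hsub)
    ((Dfn.isOrdinal hC (.var none)).congr fun w => ⟨fun h => ?_, fun h => hx.mem h⟩)).mem
      Empty.elim)
  rcases ZFSet.IsOrdinal.mem_trichotomous h hx with h' | h' | h'
  · exact h'
  · exact absurd (h' ▸ (w none).2) hxC
  · exact absurd (hC.trans _ (w none).2 _ h') hxC

end DefinablyClosed

/-! ### Natural numbers and sequences -/

section Sequences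

/-- The von Neumann natural number `n`. -/
def natSet (n : ℕ) : ZFSet.{u} := (n : Ordinal.{u}).toZFSet

/-- The set `ω` of the von Neumann natural numbers. -/
def omegaSet : ZFSet.{u} := Ordinal.omega0.{u}.toZFSet

theorem mem_omegaSet {x : ZFSet.{u}} : x ∈ omegaSet ↔ ∃ n, natSet n = x := by
  simp only [omegaSet, Ordinal.mem_toZFSet_iff, natSet]
  constructor
  · rintro ⟨a, ha, rfl⟩
    obtain ⟨n, rfl⟩ := Ordinal.lt_omega0.1 ha
    exact ⟨n, rfl⟩
  · rintro ⟨n, rfl⟩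
    exact ⟨n, Ordinal.natCast_lt_omega0 n, rfl⟩

theorem natSet_mem_omegaSet (n : ℕ) : natSet.{u} n ∈ omegaSet := mem_omegaSet.2 ⟨n, rfl⟩

theorem natSet_zero : natSet.{u} 0 = ∅ := by simp [natSet]

theorem natSet_succ (n : ℕ) : natSet.{u} (n + 1) = insert (natSet n) (natSet n) := by
  simp [natSet]

theorem natSet_injective : Function.Injective natSet.{u} := fun m n h => by
  simpa [natSet] using Ordinal.toZFSet_injective h

theorem isOrdinal_natSet (n : ℕ) : (natSet.{u} n).IsOrdinal := ZFSet.isOrdinal_toZFSet _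

theorem isOrdinal_omegaSet : omegaSet.{u}.IsOrdinal := ZFSet.isOrdinal_toZFSet _

theorem natSet_eq_empty {n : ℕ} : natSet.{u} n = ∅ ↔ n = 0 := by
  rw [← natSet_zero, natSet_injective.eq_iff]

/-- By foundation, a set whose elements are all empty or successors of its own elements contains
only natural numbers. This describes `ω` with quantifiers bounded by `w`. -/
theorem eq_omegaSet_iff {w : ZFSet.{u}} : w = omegaSet ↔
    ∅ ∈ w ∧ (∀ x ∈ w, insert x x ∈ w) ∧ ∀ x ∈ w, x = ∅ ∨ ∃ y ∈ w, x = insert y y := by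
  constructor
  · rintro rfl
    refine ⟨mem_omegaSet.2 ⟨0, natSet_zero⟩, fun x hx => ?_, fun x hx => ?_⟩
    · obtain ⟨n, rfl⟩ := mem_omegaSet.1 hx
      exact mem_omegaSet.2 ⟨n + 1, natSet_succ n⟩
    · obtain ⟨n, rfl⟩ := mem_omegaSet.1 hx
      cases n with
      | zero => exact .inl natSet_zero
      | succ n => exact .inr ⟨natSet n, natSet_mem_omegaSet n, natSet_succ n⟩
  · rintro ⟨h0, hs, h⟩
    ext x
    rw [mem_omegaSet]
    constructor
    · induction x using ZFSet.inductionOn with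
      | _ x ih =>
      intro hx
      rcases h x hx with rfl | ⟨y, hy, rfl⟩
      · exact ⟨0, natSet_zero⟩
      · obtain ⟨n, rfl⟩ := ih y (ZFSet.mem_insert _ _) hy
        exact ⟨n + 1, natSet_succ n⟩
    · rintro ⟨n, rfl⟩
      induction n with
      | zero => rwa [natSet_zero]
      | succ n ih => rw [natSet_succ]; exact hs _ ih

/-- The value at `i` of the function that `s` is the graph of. -/
def app (s i : ZFSet.{u}) : ZFSet.{u} :=
  ZFSet.sUnion (ZFSet.sep (fun y => ZFSet.pair i y ∈ s) (ZFSet.sUnion (ZFSet.sUnion s)))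

theorem snd_mem_sUnion_sUnion {s x y : ZFSet.{u}} (h : ZFSet.pair x y ∈ s) :
    y ∈ ZFSet.sUnion (ZFSet.sUnion s) := by
  refine ZFSet.mem_sUnion.2 ⟨{x, y}, ZFSet.mem_sUnion.2 ⟨_, h, ?_⟩, ?_⟩ <;> simp [ZFSet.pair]

theorem app_eq_of_forall {s i y : ZFSet.{u}} (h : ∀ z, ZFSet.pair i z ∈ s ↔ z = y) :
    app s i = y := by
  have : ZFSet.sep (fun y => ZFSet.pair i y ∈ s) (ZFSet.sUnion (ZFSet.sUnion s)) = {y} := by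
    ext z
    rw [ZFSet.mem_sep, h, ZFSet.mem_singleton]
    exact ⟨fun h => h.2, fun hz => ⟨snd_mem_sUnion_sUnion ((h z).2 hz), hz⟩⟩
  rw [app, this, ZFSet.sUnion_singleton]

/-- The graph of a function on the natural numbers. -/
def seqGraph (f : ℕ → ZFSet.{u}) : ZFSet.{u} := ZFSet.range fun n => ZFSet.pair (natSet n) (f n)

theorem mem_seqGraph {f : ℕ → ZFSet.{u}} {p : ZFSet.{u}} :
    p ∈ seqGraph f ↔ ∃ n, ZFSet.pair (natSet n) (f n) = p := ZFSet.mem_range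

@[simp]
theorem app_seqGraph (f : ℕ → ZFSet.{u}) (n : ℕ) : app (seqGraph f) (natSet n) = f n := by
  refine app_eq_of_forall fun z => ?_
  simp only [mem_seqGraph, ZFSet.pair_inj]
  constructor
  · rintro ⟨m, hm, rfl⟩
    rw [natSet_injective hm]
  · rintro rfl
    exact ⟨n, rfl, rfl⟩

variable {C : Set ZFSet.{u}} {ι : Type*} (hC : DefinablyClosed C)
include hC

theorem DfnFun.omegaSet : DfnFun C (fun _ : ι → C => omegaSet) where
  mem _ := hC.isOrdinal_mem isOrdinal_omegaSet
  graph := ((Dfn.mem (.empty hC) (.var none)).and ((Dfn.ball hC (.var none)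
    (.mem (.insert hC (.var none) (.var none)) (.var (some none)))).and
    (Dfn.ball hC (.var none) ((Dfn.eq (.var none) (.empty hC)).or
    (Dfn.bex hC (.var (some none)) (Dfn.eq (.var (some none))
      (.insert hC (.var none) (.var none)))))))).congr fun _ => eq_omegaSet_iff.symm

theorem DfnFun.natSet (n : ℕ) : DfnFun C (fun _ : ι → C => natSet n) := by
  induction n with
  | zero => exact (DfnFun.empty hC).congr fun _ => natSet_zero.symm
  | succ n ih => exact (DfnFun.insert hC ih ih).congr fun _ => (natSet_succ n).symm

theorem DfnFun.app {f g : (ι → C) → ZFSet.{u}} (hf : DfnFun C f) (hg : DfnFun C g) :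
    DfnFun C (fun v => app (f v) (g v)) :=
  DfnFun.comp₂ (F := ImpUniverse.app) (.sUnion hC (.sep hC (.sUnion hC (.sUnion hC (.var 0)))
    (Dfn.mem (.pair hC (.var (some 1)) (.var none)) (.var (some 0))))) hf hg

end Sequences

/-! ### Definable recursion on membership -/

section Iterate

/-- The iteration of `G` along membership: `iterate G a = ⋃ b ∈ a, G (iterate G b)`. -/
def iterate (G : ZFSet.{u} → ZFSet.{u}) (a : ZFSet.{u}) : ZFSet.{u} :=
  ZFSet.iUnion fun b : a => G (iterate G b.1)
termination_by a
decreasing_by exact b.2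

theorem mem_iterate {G : ZFSet.{u} → ZFSet.{u}} {a x : ZFSet.{u}} :
    x ∈ iterate G a ↔ ∃ b ∈ a, x ∈ G (iterate G b) := by
  rw [iterate, ZFSet.mem_iUnion]
  simp

/-- The graph of `iterate G` on the transitive closure of `{a}`. -/
def iterateGraph (G : ZFSet.{u} → ZFSet.{u}) (a : ZFSet.{u}) : ZFSet.{u} :=
  insert (ZFSet.pair a (iterate G a)) (ZFSet.iUnion fun b : a => iterateGraph G b.1)
termination_by a
decreasing_by exact b.2

theorem mem_iterateGraph {G : ZFSet.{u} → ZFSet.{u}} {a p : ZFSet.{u}} :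
    p ∈ iterateGraph G a ↔ p = ZFSet.pair a (iterate G a) ∨ ∃ b ∈ a, p ∈ iterateGraph G b := by
  rw [iterateGraph, ZFSet.mem_insert_iff, ZFSet.mem_iUnion]
  simp

/-- `f` is the graph of a function with transitive domain that obeys the recursion for
`iterate G`, as far as the class `C` can tell. -/
def IsAttempt (C : Set ZFSet.{u}) (G : ZFSet.{u} → ZFSet.{u}) (f : ZFSet.{u}) : Prop :=
  ∀ a ∈ C, ∀ y ∈ C, ZFSet.pair a y ∈ f →
    (∀ b ∈ a, ∃ z ∈ C, ZFSet.pair b z ∈ f) ∧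
      ∀ x ∈ C, x ∈ y ↔ ∃ b ∈ a, ∃ z ∈ C, ZFSet.pair b z ∈ f ∧ x ∈ G z

variable {C : Set ZFSet.{u}} {G : ZFSet.{u} → ZFSet.{u}}

/-- Attempts need not be assumed single-valued: induction on membership forces every value to be the
true one. -/
theorem iterate_eq_of_isAttempt (hC : DefinablyClosed C) (hG : ∀ x ∈ C, G x ∈ C)
    {f : ZFSet.{u}} (hf : IsAttempt C G f)
    {a y : ZFSet.{u}} (ha : a ∈ C) (hy : y ∈ C) (h : ZFSet.pair a y ∈ f) : y = iterate G a := by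
  induction a using ZFSet.inductionOn generalizing y with
  | _ a ih =>
  obtain ⟨h₁, h₂⟩ := hf a ha y hy h
  ext x
  rw [mem_iterate]
  constructor
  · intro hx
    obtain ⟨b, hb, z, hz, hbz, hxz⟩ := (h₂ x (hC.trans _ hy _ hx)).1 hx
    exact ⟨b, hb, ih b hb (hC.trans _ ha _ hb) hz hbz ▸ hxz⟩
  · rintro ⟨b, hb, hx⟩
    obtain ⟨z, hz, hbz⟩ := h₁ b hb
    have := ih b hb (hC.trans _ ha _ hb) hz hbz
    rw [← this] at hx
    exact (h₂ x (hC.trans _ (hG z hz) _ hx)).2 ⟨b, hb, z, hz, hbz, hx⟩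

/-- Minimality of `iterateGraph G a` among the attempts defined at `a`; this is what makes the graph
definable over `C`. -/
theorem iterateGraph_subset_of_isAttempt (hC : DefinablyClosed C) (hG : ∀ x ∈ C, G x ∈ C)
    {f : ZFSet.{u}} (hf : IsAttempt C G f)
    {a y : ZFSet.{u}} (ha : a ∈ C) (hy : y ∈ C) (h : ZFSet.pair a y ∈ f) :
    iterateGraph G a ⊆ f := by
  induction a using ZFSet.inductionOn generalizing y with
  | _ a ih =>
  intro p hp
  rcases mem_iterateGraph.1 hp with rfl | ⟨b, hb, hp⟩
  · rwa [← iterate_eq_of_isAttempt hC hG hf ha hy h]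
  · obtain ⟨z, hz, hbz⟩ := (hf a ha y hy h).1 b hb
    exact ih b hb (hC.trans _ ha _ hb) hz hbz hp

theorem pair_mem_iterateGraph_self (a : ZFSet.{u}) :
    ZFSet.pair a (iterate G a) ∈ iterateGraph G a :=
  mem_iterateGraph.2 (.inl rfl)

theorem eq_of_pair_mem_iterateGraph {a b y : ZFSet.{u}}
    (h : ZFSet.pair b y ∈ iterateGraph G a) : y = iterate G b := by
  induction a using ZFSet.inductionOn with
  | _ a ih =>
  rcases mem_iterateGraph.1 h with h | ⟨c, hc, h⟩
  · obtain ⟨rfl, rfl⟩ := ZFSet.pair_inj.1 h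
    rfl
  · exact ih c hc h

theorem pair_mem_iterateGraph_of_mem {a b c y : ZFSet.{u}}
    (h : ZFSet.pair b y ∈ iterateGraph G a) (hc : c ∈ b) :
    ZFSet.pair c (iterate G c) ∈ iterateGraph G a := by
  induction a using ZFSet.inductionOn with
  | _ a ih =>
  rcases mem_iterateGraph.1 h with h | ⟨d, hd, h⟩
  · obtain ⟨rfl, rfl⟩ := ZFSet.pair_inj.1 h
    exact mem_iterateGraph.2 (.inr ⟨c, hc, pair_mem_iterateGraph_self c⟩)
  · exact mem_iterateGraph.2 (.inr ⟨d, hd, ih d hd h⟩)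

theorem isAttempt_iterateGraph (hC : DefinablyClosed C) {a : ZFSet.{u}}
    (ha : iterateGraph G a ∈ C) : IsAttempt C G (iterateGraph G a) := by
  have key : ∀ b z, ZFSet.pair b z ∈ iterateGraph G a → z ∈ C := fun b z h => by
    obtain ⟨q, hq, hz⟩ := ZFSet.mem_sUnion.1 (snd_mem_sUnion_sUnion h)
    obtain ⟨r, hr, hq⟩ := ZFSet.mem_sUnion.1 hq
    exact hC.trans _ (hC.trans _ (hC.trans _ ha _ hr) _ hq) _ hz
  intro b _ y _ h
  refine ⟨fun c hc => ?_, fun x _ => ?_⟩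
  · have := pair_mem_iterateGraph_of_mem h hc
    exact ⟨_, key _ _ this, this⟩
  · rw [eq_of_pair_mem_iterateGraph h, mem_iterate]
    constructor
    · rintro ⟨c, hc, hx⟩
      have := pair_mem_iterateGraph_of_mem h hc
      exact ⟨c, hc, _, key _ _ this, this, hx⟩
    · rintro ⟨c, hc, z, _, hcz, hx⟩
      exact ⟨c, hc, eq_of_pair_mem_iterateGraph hcz ▸ hx⟩

/-! ### Recursion carried out inside a definably closed class, with a parameter -/

section

variable {G : ZFSet.{u} → ZFSet.{u} → ZFSet.{u}} (hC : DefinablyClosed C)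
  (hG : DfnFun C (fun v : Fin 2 → C => G (v 0) (v 1)))
include hC hG

theorem Dfn.isAttempt {ι : Type*} {f g : (ι → C) → ZFSet.{u}} (hf : DfnFun C f)
    (hg : DfnFun C g) : Dfn C (fun v => IsAttempt C (G (f v)) (g v)) :=
  Dfn.comp₂ (R := fun p f => IsAttempt C (G p) f)
    (Dfn.all (Dfn.all (Dfn.imp (.mem (.pair hC (.var (some none)) (.var none))
        (.var (some (some 1))))
      (Dfn.and
        (Dfn.ball hC (.var (some none)) (Dfn.ex (.mem (.pair hC (.var (some none)) (.var none))
          (.var (some (some (some (some 1))))))))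
        (Dfn.all (Dfn.iff (.mem (.var none) (.var (some none)))
          (Dfn.bex hC (.var (some (some none)))
          (Dfn.ex (.and (.mem (.pair hC (.var (some none)) (.var none))
            (.var (some (some (some (some (some 1)))))))
            (.mem (.var (some (some none)))
            (.comp₂ (F := G) hG (.var (some (some (some (some (some 0))))))
              (.var none)))))))))))) hf hg

/-- The two claims need a joint induction: the graphs at the elements of `a` are the attempts that
witness, inside `C`, which sets belong to the value at `a`. -/
theorem iterate_mem_and_iterateGraph_mem {p a : ZFSet.{u}} (hp : p ∈ C) (ha : a ∈ C) :
    iterate (G p) a ∈ C ∧ iterateGraph (G p) a ∈ C := by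
  have hGp : ∀ x ∈ C, G p x ∈ C := fun x hx => hG.mem ![⟨p, hp⟩, ⟨x, hx⟩]
  induction a using ZFSet.inductionOn with
  | _ a ih =>
  replace ih : ∀ b ∈ a, iterate (G p) b ∈ C ∧ iterateGraph (G p) b ∈ C :=
    fun b hb => ih b hb (hC.trans a ha b hb)
  have hatt : ∀ b ∈ a, IsAttempt C (G p) (iterateGraph (G p) b) :=
    fun b hb => isAttempt_iterateGraph hC (ih b hb).2
  have h₁ : iterate (G p) a ∈ C := by
    refine hC.mem_of_dfn (ι := Fin 2) (P := fun v x => ∃ b ∈ (v 1 : ZFSet.{u}), ∃ f ∈ C,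
      IsAttempt C (G (v 0)) f ∧ ∃ z ∈ C, ZFSet.pair b z ∈ f ∧ x ∈ G (v 0) z)
      (Dfn.bex hC (.var (some 1)) (Dfn.ex (.and (Dfn.isAttempt hC hG (.var _) (.var _))
        (Dfn.ex (.and (.mem (.pair hC (.var _) (.var _)) (.var _))
          (.mem (.var _) (.comp₂ (F := G) hG (.var _) (.var _))))))))
      ![⟨p, hp⟩, ⟨a, ha⟩] (fun x hx => ?_) (fun x _ => ?_)
    · obtain ⟨b, hb, hx⟩ := mem_iterate.1 hx
      exact hC.trans _ (hGp _ (ih b hb).1) _ hx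
    · rw [mem_iterate]
      constructor
      · rintro ⟨b, hb, hx⟩
        exact ⟨b, hb, _, (ih b hb).2, hatt b hb, _, (ih b hb).1, pair_mem_iterateGraph_self b, hx⟩
      · rintro ⟨b, hb, f, _, hf, z, hz, hbz, hx⟩
        exact ⟨b, hb, iterate_eq_of_isAttempt hC hGp hf (hC.trans a ha b hb) hz hbz ▸ hx⟩
  refine ⟨h₁, ?_⟩
  -- The graph at `b` is described as the intersection of all attempts in `C` that are defined at
  -- `b`. The value at `a`, already in `C`, serves as the third parameter.
  refine hC.mem_of_dfn (ι := Fin 3) (P := fun v q => q = ZFSet.pair (v 1) (v 2) ∨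
    ∃ b ∈ (v 1 : ZFSet.{u}), ∀ f ∈ C, IsAttempt C (G (v 0)) f →
      (∃ z ∈ C, ZFSet.pair b z ∈ f) → q ∈ f)
    (Dfn.or (.eq (.var _) (.pair hC (.var (some 1)) (.var (some 2))))
      (Dfn.bex hC (.var (some 1)) (Dfn.all (.imp (Dfn.isAttempt hC hG (.var _) (.var _))
        (.imp (Dfn.ex (.mem (.pair hC (.var _) (.var _)) (.var _))) (.mem (.var _) (.var _)))))))
    ![⟨p, hp⟩, ⟨a, ha⟩, ⟨_, h₁⟩] (fun q hq => ?_) (fun q _ => ?_)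
  · rcases mem_iterateGraph.1 hq with rfl | ⟨b, hb, hq⟩
    · exact (DfnFun.pair hC (.var (0 : Fin 2)) (.var 1)).mem ![⟨a, ha⟩, ⟨_, h₁⟩]
    · exact hC.trans _ (ih b hb).2 _ hq
  · rw [mem_iterateGraph]
    refine or_congr Iff.rfl ⟨?_, ?_⟩
    · rintro ⟨b, hb, hq⟩
      exact ⟨b, hb, fun f _ hf ⟨z, hz, hbz⟩ =>
        iterateGraph_subset_of_isAttempt hC hGp hf (hC.trans a ha b hb) hz hbz hq⟩
    · rintro ⟨b, hb, h⟩
      exact ⟨b, hb, h _ (ih b hb).2 (hatt b hb) ⟨_, (ih b hb).1, pair_mem_iterateGraph_self b⟩⟩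

theorem DfnFun.iterate {ι : Type*} {f g : (ι → C) → ZFSet.{u}} (hf : DfnFun C f)
    (hg : DfnFun C g) : DfnFun C (fun v => iterate (G (f v)) (g v)) := by
  refine DfnFun.comp₂ (F := fun p a => ImpUniverse.iterate (G p) a)
    ⟨fun v => (iterate_mem_and_iterateGraph_mem hC hG (v 0).2 (v 1).2).1, ?_⟩ hf hg
  refine (Dfn.ex (P := fun w f => IsAttempt C (G (w (some 0))) f ∧
    ZFSet.pair (w (some 1)) (w none) ∈ f)
    (.and (Dfn.isAttempt hC hG (.var _) (.var _))
      (.mem (.pair hC (.var _) (.var _)) (.var _)))).congr fun w => ?_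
  constructor
  · rintro ⟨f, _, hf, h⟩
    exact iterate_eq_of_isAttempt hC (fun x hx => hG.mem ![w (some 0), ⟨x, hx⟩]) hf
      (w (some 1)).2 (w none).2 h
  · intro h
    have := (iterate_mem_and_iterateGraph_mem hC hG (w (some 0)).2 (w (some 1)).2).2
    exact ⟨_, this, isAttempt_iterateGraph hC this, h ▸ pair_mem_iterateGraph_self _⟩

end

end Iterate

/-! ### Definably closed classes are models of ZF -/

section ModelsZF

variable {C : Set ZFSet.{u}}

theorem realize_memF {m : ℕ} {i j : Fin m} {v : Empty → C} {xs : Fin m → C} :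
    (memF m i j).Realize v xs ↔ (xs i : ZFSet.{u}) ∈ (xs j : ZFSet.{u}) := by
  rw [memF, BoundedFormula.realize_rel₂]
  rfl

theorem realize_eqF {m : ℕ} {i j : Fin m} {v : Empty → C} {xs : Fin m → C} :
    (eqF m i j).Realize v xs ↔ xs i = xs j := by
  simp [eqF]

theorem realize_substF {k m : ℕ} {φ : setLang.Formula (Fin k)} {w : Fin k → Fin m}
    {v : Empty → C} {xs : Fin m → C} :
    (substF φ w).Realize v xs ↔ φ.Realize (fun i => xs (w i)) := by
  rw [substF]
  refine BoundedFormula.realize_relabel.trans ?_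
  rw [Formula.Realize, iff_eq_eq]
  congr 1
  exact Subsingleton.elim _ _

theorem snoc_three {X : Type*} {n : ℕ} (xs : Fin n → X) (a b c : X) :
    let ys : Fin (n + 3) → X := Fin.snoc (α := fun _ => X) (Fin.snoc (α := fun _ => X)
      (Fin.snoc (α := fun _ => X) xs a) b) c
    (∀ i, ys (Fin.castAdd 3 i) = xs i) ∧ ys (Fin.natAdd n 0) = a ∧ ys (Fin.natAdd n 1) = b ∧
      ys (Fin.natAdd n 2) = c := by
  refine ⟨fun i => ?_, ?_, ?_, ?_⟩
  · change Fin.snoc _ _ (Fin.castSucc (Fin.castSucc (Fin.castSucc i))) = _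
    simp only [Fin.snoc_castSucc]
  all_goals simp [Fin.snoc, Fin.natAdd]

theorem snoc_four {X : Type*} {n : ℕ} (xs : Fin n → X) (a b c d : X) :
    let ys : Fin (n + 4) → X := Fin.snoc (α := fun _ => X) (Fin.snoc (α := fun _ => X)
      (Fin.snoc (α := fun _ => X) (Fin.snoc (α := fun _ => X) xs a) b) c) d
    (∀ i, ys (Fin.castAdd 4 i) = xs i) ∧ ys (Fin.natAdd n 0) = a ∧ ys (Fin.natAdd n 1) = b ∧
      ys (Fin.natAdd n 2) = c ∧ ys (Fin.natAdd n 3) = d := by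
  refine ⟨fun i => ?_, ?_, ?_, ?_, ?_⟩
  · change Fin.snoc _ _ (Fin.castSucc (Fin.castSucc (Fin.castSucc (Fin.castSucc i)))) = _
    simp only [Fin.snoc_castSucc]
  all_goals simp [Fin.snoc, Fin.natAdd]

theorem comp_snoc {n r : ℕ} {ys : Fin (n + r) → C} {xs : Fin n → C}
    (h : ∀ i, ys (Fin.castAdd r i) = xs i) (i : Fin (n + r)) :
    (fun k => ys (Fin.snoc (α := fun _ => Fin (n + r)) (Fin.castAdd r) i k)) =
      Fin.snoc (α := fun _ => C) xs (ys i) := by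
  funext k
  refine Fin.lastCases ?_ (fun k => ?_) k <;> simp [h]

theorem comp_snoc_snoc {n r : ℕ} {ys : Fin (n + r) → C} {xs : Fin n → C}
    (h : ∀ i, ys (Fin.castAdd r i) = xs i) (i j : Fin (n + r)) :
    (fun k => ys (Fin.snoc (α := fun _ => Fin (n + r))
      (Fin.snoc (α := fun _ => Fin (n + r)) (Fin.castAdd r) i) j k)) =
      Fin.snoc (α := fun _ => C) (Fin.snoc (α := fun _ => C) xs (ys i)) (ys j) := by
  funext k
  refine Fin.lastCases ?_ (fun k => Fin.lastCases ?_ (fun k => ?_) k) k <;> simp [h]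

variable (hC : DefinablyClosed C)
include hC

/-- The bound `B` need not lie in `C`: separation in `V` produces the set, and closure of `C`
captures it. Hence power set and replacement in `C` follow from those in `V`. -/
theorem DefinablyClosed.exists_of_bounded {ι : Type*} {P : (ι → C) → C → Prop}
    (hP : Dfn C (fun w : Option ι → C => P (fun i => w (some i)) (w none))) (v : ι → C)
    (B : ZFSet.{u}) (hB : ∀ x : C, P v x → (x : ZFSet.{u}) ∈ B) :
    ∃ b : C, ∀ x : C, (x : ZFSet.{u}) ∈ (b : ZFSet.{u}) ↔ P v x := by
  have key : ∀ x : C, (x : ZFSet.{u}) ∈ ZFSet.sep (fun x => ∃ h : x ∈ C, P v ⟨x, h⟩) B ↔ P v x :=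
    fun x => by
      rw [ZFSet.mem_sep]
      exact ⟨fun ⟨_, _, h⟩ => h, fun h => ⟨hB x h, x.2, h⟩⟩
  refine ⟨⟨ZFSet.sep (fun x => ∃ h : x ∈ C, P v ⟨x, h⟩) B, hC.compr _ ?_ ?_⟩, key⟩
  · intro x hx
    exact (ZFSet.mem_sep.1 hx).2.1
  · simp only [key]
    exact definable₁_of_dfn hP v fun _ => trivial

theorem DefinablyClosed.ext {x y : C}
    (h : ∀ z : C, (z : ZFSet.{u}) ∈ (x : ZFSet.{u}) ↔ (z : ZFSet.{u}) ∈ (y : ZFSet.{u})) :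
    x = y := by
  refine Subtype.ext (ZFSet.ext fun z => ⟨fun hz => ?_, fun hz => ?_⟩)
  · exact (h ⟨z, hC.trans _ x.2 _ hz⟩).1 hz
  · exact (h ⟨z, hC.trans _ y.2 _ hz⟩).2 hz

theorem DefinablyClosed.realize_extensionality : C ⊨ extensionality := by
  simp only [Sentence.Realize, Formula.Realize, extensionality, BoundedFormula.realize_all,
    BoundedFormula.realize_imp, BoundedFormula.realize_iff, realize_memF, realize_eqF]
  intro x y h
  simp [Fin.snoc] at h ⊢
  exact hC.ext fun z => h z z.2

theorem DefinablyClosed.realize_foundation : C ⊨ foundation := by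
  simp only [Sentence.Realize, Formula.Realize, foundation, BoundedFormula.realize_all,
    BoundedFormula.realize_imp, BoundedFormula.realize_ex, BoundedFormula.realize_inf,
    BoundedFormula.realize_not, realize_memF]
  rintro x ⟨y, hy⟩
  have hx : (x : ZFSet.{u}) ≠ ∅ := by
    intro h
    simp [Fin.snoc, h] at hy
  obtain ⟨z, hz, hxz⟩ := ZFSet.regularity x hx
  refine ⟨⟨z, hC.trans _ x.2 _ hz⟩, by simpa [Fin.snoc] using hz, ?_⟩
  rintro ⟨t, ht₁, ht₂⟩
  have : (t : ZFSet.{u}) ∈ (x : ZFSet.{u}) ∩ z :=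
    ZFSet.mem_inter.2 ⟨by simpa [Fin.snoc] using ht₂, by simpa [Fin.snoc] using ht₁⟩
  rw [hxz] at this
  exact ZFSet.notMem_empty _ this

theorem DefinablyClosed.realize_pairing : C ⊨ pairing := by
  simp only [Sentence.Realize, Formula.Realize, pairing, BoundedFormula.realize_all,
    BoundedFormula.realize_iff, BoundedFormula.realize_ex, BoundedFormula.realize_sup,
    realize_memF, realize_eqF]
  intro x y
  obtain ⟨b, hb⟩ := hC.exists_of_bounded (ι := Fin 2)
    (P := fun v z => (z : ZFSet.{u}) = v 0 ∨ (z : ZFSet.{u}) = v 1)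
    (.or (.eq_var _ _) (.eq_var _ _)) ![x, y] {(x : ZFSet.{u}), (y : ZFSet.{u})}
    (fun z hz => ZFSet.mem_pair.2 hz)
  refine ⟨b, fun z => ?_⟩
  simpa [Fin.snoc, Subtype.ext_iff] using hb z

theorem DefinablyClosed.realize_union : C ⊨ union := by
  simp only [Sentence.Realize, Formula.Realize, union, BoundedFormula.realize_all,
    BoundedFormula.realize_iff, BoundedFormula.realize_ex, BoundedFormula.realize_inf,
    realize_memF]
  intro x
  obtain ⟨b, hb⟩ := hC.exists_of_bounded (ι := Fin 1)
    (P := fun v z => ∃ y ∈ C, y ∈ (v 0 : ZFSet.{u}) ∧ (z : ZFSet.{u}) ∈ y)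
    (.ex (.and (.mem_var _ _) (.mem_var _ _))) ![x] (ZFSet.sUnion x)
    (fun z ⟨y, _, hy, hz⟩ => ZFSet.mem_sUnion.2 ⟨y, hy, hz⟩)
  refine ⟨b, fun z => ?_⟩
  simpa [Fin.snoc, and_left_comm] using hb z

theorem DefinablyClosed.realize_powerSet : C ⊨ powerSet := by
  simp only [Sentence.Realize, Formula.Realize, powerSet, BoundedFormula.realize_all,
    BoundedFormula.realize_iff, BoundedFormula.realize_ex, BoundedFormula.realize_imp,
    realize_memF]
  intro x
  obtain ⟨b, hb⟩ := hC.exists_of_bounded (ι := Fin 1)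
    (P := fun v z => ∀ y ∈ C, y ∈ (z : ZFSet.{u}) → y ∈ (v 0 : ZFSet.{u}))
    (.all (.imp (.mem_var _ _) (.mem_var _ _))) ![x] (ZFSet.powerset x)
    (fun z hz => ZFSet.mem_powerset.2 fun y hy => hz y (hC.trans _ z.2 _ hy) hy)
  refine ⟨b, fun z => ?_⟩
  simpa [Fin.snoc] using hb z

theorem DefinablyClosed.realize_infinity : C ⊨ infinity := by
  simp only [Sentence.Realize, Formula.Realize, infinity, BoundedFormula.realize_all,
    BoundedFormula.realize_iff, BoundedFormula.realize_ex, BoundedFormula.realize_imp,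
    BoundedFormula.realize_inf, BoundedFormula.realize_sup, BoundedFormula.realize_not,
    realize_memF, realize_eqF]
  obtain ⟨h0, hs, -⟩ := eq_omegaSet_iff.1 (rfl : omegaSet.{u} = omegaSet)
  have hω : omegaSet ∈ C := hC.isOrdinal_mem isOrdinal_omegaSet
  refine ⟨⟨omegaSet, hω⟩, ⟨⟨∅, hC.trans _ hω _ h0⟩, ?_, fun y => ?_⟩, fun x hx => ?_⟩
  · simpa [Fin.snoc] using h0
  · simp [Fin.snoc]
  · replace hx : (x : ZFSet.{u}) ∈ omegaSet := by simpa [Fin.snoc] using hx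
    refine ⟨⟨_, hC.trans _ hω _ (hs x hx)⟩, ?_, fun z => ?_⟩
    · simpa [Fin.snoc] using hs x hx
    · simp [Fin.snoc, Subtype.ext_iff, or_comm]

theorem DefinablyClosed.realize_separation {n : ℕ} (φ : setLang.Formula (Fin (n + 1))) :
    C ⊨ separation φ := by
  rw [Sentence.Realize, separation, BoundedFormula.realize_alls]
  intro xs
  simp only [BoundedFormula.realize_all,
    BoundedFormula.realize_iff, BoundedFormula.realize_ex, BoundedFormula.realize_inf,
    realize_memF, realize_substF]
  intro a
  have hP : Dfn C (fun w : Option (Option (Fin n)) → C =>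
      (w none : ZFSet.{u}) ∈ (w (some none) : ZFSet.{u}) ∧
        φ.Realize (Fin.snoc (α := fun _ => C) (fun i => w (some (some i))) (w none))) :=
    .and (.mem_var _ _) ⟨φ.relabel
      (Fin.snoc (α := fun _ => Option (Option (Fin n))) (fun i => some (some i)) none), fun w => by
        rw [Formula.realize_relabel, iff_eq_eq]
        congr 1
        funext i
        refine Fin.lastCases ?_ (fun i => ?_) i <;> simp⟩
  obtain ⟨b, hb⟩ := hC.exists_of_bounded (ι := Option (Fin n))
    (P := fun v x => (x : ZFSet.{u}) ∈ (v none : ZFSet.{u}) ∧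
      φ.Realize (Fin.snoc (α := fun _ => C) (fun i => v (some i)) x)) hP
    (fun o => o.elim a xs) a (fun x hx => hx.1)
  refine ⟨b, fun x => ?_⟩
  obtain ⟨h, h0, h1, h2⟩ := snoc_three xs a b x
  rw [comp_snoc h, h0, h1, h2]
  exact hb x

theorem DefinablyClosed.realize_replacement {n : ℕ} (φ : setLang.Formula (Fin (n + 2))) :
    C ⊨ replacement φ := by
  rw [Sentence.Realize, replacement, BoundedFormula.realize_alls]
  intro xs
  simp only [BoundedFormula.realize_all, BoundedFormula.realize_imp,
    BoundedFormula.realize_iff, BoundedFormula.realize_ex, BoundedFormula.realize_inf,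
    realize_memF, realize_eqF, substF₂, realize_substF]
  intro a
  let Φ : C → C → Prop := fun x y =>
    φ.Realize (Fin.snoc (α := fun _ => C) (Fin.snoc (α := fun _ => C) xs x) y)
  -- The repeated `x ∈ C` separates two roles: the first bounds the quantifier as `Dfn.ex` requires,
  -- the second supplies the proof needed to evaluate `φ` at `x`.
  have hP : Dfn C (fun w : Option (Option (Fin n)) → C =>
      ∃ x ∈ C, ∃ h : x ∈ C, x ∈ (w (some none) : ZFSet.{u}) ∧
        φ.Realize (Fin.snoc (α := fun _ => C) (Fin.snoc (α := fun _ => C)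
          (fun i => w (some (some i))) ⟨x, h⟩) (w none))) := by
    refine .ex ((Dfn.and (.mem_var none (some (some none))) ⟨φ.relabel
      (Fin.snoc (α := fun _ => Option (Option (Option (Fin n))))
        (Fin.snoc (α := fun _ => Option (Option (Option (Fin n))))
          (fun i => some (some (some i))) none) (some none)), fun w => Iff.rfl⟩).congr fun w => ?_)
    simp only [Subtype.coe_prop, exists_true_left]
    refine and_congr Iff.rfl ?_
    rw [Formula.realize_relabel]
    congr! 1
    funext i
    refine Fin.lastCases ?_ (fun i => Fin.lastCases ?_ (fun i => ?_) i) i <;> simp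
  intro hfun
  have hfun' : ∀ x y z : C, (x : ZFSet.{u}) ∈ (a : ZFSet.{u}) → Φ x y → Φ x z → y = z := by
    intro x y z hx hy hz
    obtain ⟨h, h0, h1, h2, h3⟩ := snoc_four xs a x y z
    have := hfun x y z
    rw [comp_snoc_snoc h, comp_snoc_snoc h, h0, h1, h2, h3] at this
    exact this ⟨hx, hy, hz⟩
  obtain ⟨b, hb⟩ := hC.exists_of_bounded (ι := Option (Fin n)) (P := fun v y =>
      ∃ x ∈ C, ∃ h : x ∈ C, x ∈ (v none : ZFSet.{u}) ∧
        φ.Realize (Fin.snoc (α := fun _ => C) (Fin.snoc (α := fun _ => C)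
          (fun i => v (some i)) ⟨x, h⟩) y)) hP
    (fun o => o.elim a xs)
    -- The bound is the image of `a` formed in `V`. Points without a value are sent to `∅`, which is
    -- harmless because only an upper bound is needed.
    (ZFSet.range fun x : (a : ZFSet.{u}) => open Classical in
      if h : ∃ y : C, Φ ⟨x, hC.trans _ a.2 _ x.2⟩ y then (h.choose : ZFSet.{u}) else ∅) (by
    rintro y ⟨x, _, hx, hxa, hxy⟩
    replace hxa : x ∈ (a : ZFSet.{u}) := hxa
    have h : ∃ y : C, Φ ⟨x, hx⟩ y := ⟨y, hxy⟩
    refine ZFSet.mem_range.2 ⟨⟨x, hxa⟩, ?_⟩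
    rw [dif_pos h]
    exact congrArg _ (hfun' ⟨x, hx⟩ _ _ hxa h.choose_spec hxy))
  refine ⟨b, fun y => ?_⟩
  obtain ⟨-, -, h1, h2⟩ := snoc_three xs a b y
  rw [h1, h2, hb y]
  constructor
  · rintro ⟨x, _, hx, hxa, hxy⟩
    obtain ⟨h, h0, -, h2, h3⟩ := snoc_four xs a b y ⟨x, hx⟩
    refine ⟨⟨x, hx⟩, ?_⟩
    rw [comp_snoc_snoc h, h0, h2, h3]
    exact ⟨hxa, hxy⟩
  · rintro ⟨x, hxy⟩
    obtain ⟨h, h0, -, h2, h3⟩ := snoc_four xs a b y x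
    rw [comp_snoc_snoc h, h0, h2, h3] at hxy
    exact ⟨x, x.2, x.2, hxy.1, hxy.2⟩

theorem DefinablyClosed.models_ZF : C ⊨ ZF := by
  refine ⟨?_⟩
  rintro σ ((h | ⟨n, φ, rfl⟩) | ⟨n, φ, rfl⟩)
  · rcases h with rfl | rfl | rfl | rfl | rfl | rfl
    exacts [hC.realize_extensionality, hC.realize_foundation, hC.realize_pairing,
      hC.realize_union, hC.realize_powerSet, hC.realize_infinity]
  · exact hC.realize_separation φ
  · exact hC.realize_replacement φ

end ModelsZF

/-! ### The family of definable relations on a set of sequences -/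

section Family

variable {C : Set ZFSet.{u}} {ι : Type*}

/-- The sequences `s : ω → M ∪ K` in `C` with `s 0 ∈ K` and `s (i + 1) ∈ M` for all `i`. -/
def points (C : Set ZFSet.{u}) (M K : ZFSet.{u}) : ZFSet.{u} :=
  ZFSet.sep (fun s => s ∈ C ∧ ∃ f : ℕ → ZFSet.{u}, s = seqGraph f ∧ f 0 ∈ K ∧ ∀ i, f (i + 1) ∈ M)
    (ZFSet.powerset (ZFSet.prod omegaSet (M ∪ K)))

theorem mem_points {M K s : ZFSet.{u}} : s ∈ points C M K ↔
    s ∈ C ∧ ∃ f : ℕ → ZFSet.{u}, s = seqGraph f ∧ f 0 ∈ K ∧ ∀ i, f (i + 1) ∈ M := by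
  rw [points, ZFSet.mem_sep, and_iff_right_iff_imp]
  rintro ⟨_, f, rfl, h0, hs⟩
  refine ZFSet.mem_powerset.2 fun p hp => ?_
  obtain ⟨n, rfl⟩ := mem_seqGraph.1 hp
  refine ZFSet.pair_mem_prod.2 ⟨natSet_mem_omegaSet n, ZFSet.mem_union.2 ?_⟩
  cases n with
  | zero => exact .inr h0
  | succ n => exact .inl (hs n)

/-- The external function on `ℕ` is eliminated in favour of conditions that can be expressed in `C`.
-/
theorem mem_points_iff {M K s : ZFSet.{u}} : s ∈ points C M K ↔
    s ∈ C ∧ ((∀ p ∈ s, ∃ n ∈ omegaSet, p = ZFSet.pair n (app s n)) ∧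
      ∀ n ∈ omegaSet, ZFSet.pair n (app s n) ∈ s) ∧
      app s ∅ ∈ K ∧ ∀ n ∈ omegaSet, n ≠ ∅ → app s n ∈ M := by
  rw [mem_points]
  refine and_congr Iff.rfl ⟨?_, ?_⟩
  · rintro ⟨f, rfl, h0, hs⟩
    refine ⟨⟨fun p hp => ?_, fun n hn => ?_⟩, ?_, fun n hn hn0 => ?_⟩
    · obtain ⟨n, rfl⟩ := mem_seqGraph.1 hp
      exact ⟨natSet n, natSet_mem_omegaSet n, by rw [app_seqGraph]⟩
    · obtain ⟨n, rfl⟩ := mem_omegaSet.1 hn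
      exact mem_seqGraph.2 ⟨n, by rw [app_seqGraph]⟩
    · rwa [← natSet_zero, app_seqGraph]
    · obtain ⟨n, rfl⟩ := mem_omegaSet.1 hn
      cases n with
      | zero => exact absurd natSet_zero hn0
      | succ n => rw [app_seqGraph]; exact hs n
  · rintro ⟨⟨h₁, h₂⟩, h0, hs⟩
    refine ⟨fun n => app s (natSet n), ?_, ?_, fun i => ?_⟩
    · ext p
      rw [mem_seqGraph]
      constructor
      · intro hp
        obtain ⟨_, hn, rfl⟩ := h₁ p hp
        obtain ⟨n, rfl⟩ := mem_omegaSet.1 hn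
        exact ⟨n, rfl⟩
      · rintro ⟨n, rfl⟩
        exact h₂ _ (natSet_mem_omegaSet n)
    · simpa [natSet_zero] using h0
    · exact hs _ (natSet_mem_omegaSet _) (by simp [natSet_eq_empty])

/-- `s` and `t` take the same values, except possibly at `i`. -/
def AgreeOff (i s t : ZFSet.{u}) : Prop := ∀ j ∈ omegaSet, j ≠ i → app s j = app t j

/-- The sequences `s ∈ T` with `s i ∈ s j`. -/
def atomMem (T i j : ZFSet.{u}) : ZFSet.{u} := ZFSet.sep (fun s => app s i ∈ app s j) T

/-- The sequences `s ∈ T` with `s i = s j`. -/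
def atomEq (T i j : ZFSet.{u}) : ZFSet.{u} := ZFSet.sep (fun s => app s i = app s j) T

/-- The implication of two relations on `T`. -/
def relImp (T R S : ZFSet.{u}) : ZFSet.{u} := ZFSet.sep (fun s => s ∈ R → s ∈ S) T

/-- The projection of a relation on `T` along the coordinate `i`. -/
def relEx (T i R : ZFSet.{u}) : ZFSet.{u} := ZFSet.sep (fun s => ∃ t ∈ R, AgreeOff i s t) T

/-- The basic relations on `T`, and those obtained from the relations in `F` by an implication or
a projection. The coordinate `0` is not compared with others and not projected along. -/
def familyStep (T F : ZFSet.{u}) : ZFSet.{u} :=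
  ZFSet.sep (fun y =>
    (∃ i ∈ omegaSet, ∃ j ∈ omegaSet, i ≠ ∅ ∧ y = atomMem T i j) ∨
    (∃ i ∈ omegaSet, ∃ j ∈ omegaSet, i ≠ ∅ ∧ j ≠ ∅ ∧ y = atomEq T i j) ∨
    (∃ R ∈ F, ∃ S ∈ F, y = relImp T R S) ∨
    ∃ i ∈ omegaSet, i ≠ ∅ ∧ ∃ R ∈ F, y = relEx T i R) (ZFSet.powerset T)

/-- The relations on `T` that are generated by the basic ones. -/
def family (T : ZFSet.{u}) : ZFSet.{u} := iterate (familyStep T) omegaSet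

theorem mem_familyStep {T F y : ZFSet.{u}} : y ∈ familyStep T F ↔
    (∃ i ∈ omegaSet, ∃ j ∈ omegaSet, i ≠ ∅ ∧ y = atomMem T i j) ∨
    (∃ i ∈ omegaSet, ∃ j ∈ omegaSet, i ≠ ∅ ∧ j ≠ ∅ ∧ y = atomEq T i j) ∨
    (∃ R ∈ F, ∃ S ∈ F, y = relImp T R S) ∨
    ∃ i ∈ omegaSet, i ≠ ∅ ∧ ∃ R ∈ F, y = relEx T i R := by
  rw [familyStep, ZFSet.mem_sep, and_iff_right_iff_imp, ZFSet.mem_powerset]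
  rintro (⟨i, -, j, -, -, rfl⟩ | ⟨i, -, j, -, -, -, rfl⟩ | ⟨R, -, S, -, rfl⟩ |
    ⟨i, -, -, R, -, rfl⟩) <;>
  exact ZFSet.sep_subset

theorem iterate_natSet_mono {G : ZFSet.{u} → ZFSet.{u}} {m n : ℕ} (h : m ≤ n) {x : ZFSet.{u}}
    (hx : x ∈ iterate G (natSet m)) : x ∈ iterate G (natSet n) := by
  obtain ⟨b, hb, hx⟩ := mem_iterate.1 hx
  exact mem_iterate.2 ⟨b, Ordinal.toZFSet_monotone (Nat.cast_le.2 h) hb, hx⟩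

/-- The finite stages increase, so finitely many members of the family always occur at a common
stage. -/
theorem mem_family_iff {T R : ZFSet.{u}} :
    R ∈ family T ↔ ∃ n, R ∈ iterate (familyStep T) (natSet n) := by
  constructor
  · intro h
    obtain ⟨b, hb, h⟩ := mem_iterate.1 h
    obtain ⟨n, rfl⟩ := mem_omegaSet.1 hb
    refine ⟨n + 1, mem_iterate.2 ⟨natSet n, ?_, h⟩⟩
    rw [natSet_succ]
    exact ZFSet.mem_insert _ _
  · rintro ⟨n, h⟩
    obtain ⟨b, hb, h⟩ := mem_iterate.1 h
    exact mem_iterate.2 ⟨b, isOrdinal_omegaSet.mem_trans hb (natSet_mem_omegaSet n), h⟩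

theorem mem_family_of_mem_familyStep {T R : ZFSet.{u}} {n : ℕ}
    (h : R ∈ familyStep T (iterate (familyStep T) (natSet n))) : R ∈ family T :=
  mem_iterate.2 ⟨natSet n, natSet_mem_omegaSet n, h⟩

theorem atomMem_mem_family (T : ZFSet.{u}) (i j : ℕ) :
    atomMem T (natSet (i + 1)) (natSet j) ∈ family T :=
  mem_family_of_mem_familyStep (n := 0) (mem_familyStep.2 (.inl ⟨_, natSet_mem_omegaSet _,
    _, natSet_mem_omegaSet _, by simp [natSet_eq_empty], rfl⟩))

theorem atomEq_mem_family (T : ZFSet.{u}) (i j : ℕ) :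
    atomEq T (natSet (i + 1)) (natSet (j + 1)) ∈ family T :=
  mem_family_of_mem_familyStep (n := 0) (mem_familyStep.2 (.inr (.inl ⟨_, natSet_mem_omegaSet _,
    _, natSet_mem_omegaSet _, by simp [natSet_eq_empty], by simp [natSet_eq_empty], rfl⟩)))

theorem relImp_mem_family {T R S : ZFSet.{u}} (hR : R ∈ family T) (hS : S ∈ family T) :
    relImp T R S ∈ family T := by
  obtain ⟨m, hR⟩ := mem_family_iff.1 hR
  obtain ⟨n, hS⟩ := mem_family_iff.1 hS
  exact mem_family_of_mem_familyStep (n := max m n) (mem_familyStep.2 (.inr (.inr (.inl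
    ⟨R, iterate_natSet_mono (le_max_left _ _) hR, S, iterate_natSet_mono (le_max_right _ _) hS,
      rfl⟩))))

theorem relEx_mem_family {T R : ZFSet.{u}} (i : ℕ) (hR : R ∈ family T) :
    relEx T (natSet (i + 1)) R ∈ family T := by
  obtain ⟨n, hR⟩ := mem_family_iff.1 hR
  exact mem_family_of_mem_familyStep (mem_familyStep.2 (.inr (.inr (.inr
    ⟨_, natSet_mem_omegaSet _, by simp [natSet_eq_empty], R, hR, rfl⟩))))

theorem family_induction {T : ZFSet.{u}} {p : ZFSet.{u} → Prop}
    (hmem : ∀ i j : ℕ, p (atomMem T (natSet (i + 1)) (natSet j)))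
    (heq : ∀ i j : ℕ, p (atomEq T (natSet (i + 1)) (natSet (j + 1))))
    (himp : ∀ R S, p R → p S → p (relImp T R S))
    (hex : ∀ (i : ℕ) R, p R → p (relEx T (natSet (i + 1)) R)) {R : ZFSet.{u}}
    (hR : R ∈ family T) : p R := by
  have hω : ∀ i : ZFSet.{u}, i ∈ omegaSet → i ≠ ∅ → ∃ n : ℕ, i = natSet (n + 1) := by
    intro i hi hi0
    obtain ⟨n, rfl⟩ := mem_omegaSet.1 hi
    cases n with
    | zero => exact absurd natSet_zero hi0
    | succ n => exact ⟨n, rfl⟩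
  have key : ∀ a, ∀ R ∈ iterate (familyStep T) a, p R := by
    intro a
    induction a using ZFSet.inductionOn with
    | _ a ih =>
    intro R hR
    obtain ⟨b, hb, hR⟩ := mem_iterate.1 hR
    rcases mem_familyStep.1 hR with ⟨i, hi, j, hj, hi0, rfl⟩ | ⟨i, hi, j, hj, hi0, hj0, rfl⟩ |
      ⟨R, hR', S, hS, rfl⟩ | ⟨i, hi, hi0, R, hR', rfl⟩
    · obtain ⟨m, rfl⟩ := hω i hi hi0
      obtain ⟨n, rfl⟩ := mem_omegaSet.1 hj
      exact hmem m n
    · obtain ⟨m, rfl⟩ := hω i hi hi0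
      obtain ⟨n, rfl⟩ := hω j hj hj0
      exact heq m n
    · exact himp R S (ih b hb R hR') (ih b hb S hS)
    · obtain ⟨m, rfl⟩ := hω i hi hi0
      exact hex m R (ih b hb R hR')
  exact key _ R hR

theorem subset_of_mem_family {T R : ZFSet.{u}} (hR : R ∈ family T) : R ⊆ T := by
  refine family_induction (p := fun R => R ⊆ T) ?_ ?_ ?_ ?_ hR <;> intros <;>
  exact ZFSet.sep_subset

/-! ### The family as a definable function inside a definably closed class -/

section

variable (hC : DefinablyClosed C)
include hC

theorem DfnFun.points {f g : (ι → C) → ZFSet.{u}} (hf : DfnFun C f) (hg : DfnFun C g) :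
    DfnFun C (fun v => points C (f v) (g v)) := by
  refine DfnFun.comp₂ (.of_mem hC (fun _ _ hs => (mem_points.1 hs).1) (.congr ?_
      fun w => (mem_points_iff.trans (and_iff_right (w none).2)).symm)) hf hg
  exact (.and (.and
      (.ball hC (.var none) (.bex hC (.omegaSet hC)
        (.eq (.var (some none)) (.pair hC (.var none) (.app hC (.var (some (some none)))
          (.var none))))))
      (.ball hC (.omegaSet hC) (.mem (.pair hC (.var none) (.app hC (.var (some none))
        (.var none))) (.var (some none)))))
      (.and (.mem (.app hC (.var none) (.empty hC)) (.var (some 1)))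
        (.ball hC (.omegaSet hC) (.imp (.not (.eq (.var none) (.empty hC)))
          (.mem (.app hC (.var (some none)) (.var none)) (.var (some (some 0))))))))

theorem Dfn.agreeOff {f g h : (ι → C) → ZFSet.{u}} (hf : DfnFun C f) (hg : DfnFun C g)
    (hh : DfnFun C h) : Dfn C (fun v => AgreeOff (f v) (g v) (h v)) :=
  Dfn.comp₃ (R := AgreeOff) (.ball hC (.omegaSet hC) (.imp (.not (.eq (.var none) (.var (some 0))))
    (.eq (.app hC (.var (some 1)) (.var none)) (.app hC (.var (some 2)) (.var none))))) hf hg hh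

theorem DfnFun.atomMem {f g h : (ι → C) → ZFSet.{u}} (hf : DfnFun C f) (hg : DfnFun C g)
    (hh : DfnFun C h) : DfnFun C (fun v => atomMem (f v) (g v) (h v)) :=
  DfnFun.comp₃ (F := ImpUniverse.atomMem) (.sep hC (.var 0) (.mem
    (.app hC (.var none) (.var (some 1))) (.app hC (.var none) (.var (some 2))))) hf hg hh

theorem DfnFun.atomEq {f g h : (ι → C) → ZFSet.{u}} (hf : DfnFun C f) (hg : DfnFun C g)
    (hh : DfnFun C h) : DfnFun C (fun v => atomEq (f v) (g v) (h v)) :=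
  DfnFun.comp₃ (F := ImpUniverse.atomEq) (.sep hC (.var 0) (.eq
    (.app hC (.var none) (.var (some 1))) (.app hC (.var none) (.var (some 2))))) hf hg hh

theorem DfnFun.relImp {f g h : (ι → C) → ZFSet.{u}} (hf : DfnFun C f) (hg : DfnFun C g)
    (hh : DfnFun C h) : DfnFun C (fun v => relImp (f v) (g v) (h v)) :=
  DfnFun.comp₃ (F := ImpUniverse.relImp) (.sep hC (.var 0) (.imp
    (.mem (.var none) (.var (some 1))) (.mem (.var none) (.var (some 2))))) hf hg hh

theorem DfnFun.relEx {f g h : (ι → C) → ZFSet.{u}} (hf : DfnFun C f) (hg : DfnFun C g)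
    (hh : DfnFun C h) : DfnFun C (fun v => relEx (f v) (g v) (h v)) :=
  DfnFun.comp₃ (F := ImpUniverse.relEx) (.sep hC (.var 0) (.bex hC (.var (some 2))
    (Dfn.agreeOff hC (.var (some (some 1))) (.var (some none)) (.var none)))) hf hg hh

theorem DfnFun.familyStep {f g : (ι → C) → ZFSet.{u}} (hf : DfnFun C f) (hg : DfnFun C g) :
    DfnFun C (fun v => familyStep (f v) (g v)) := by
  refine DfnFun.comp₂ (.of_mem hC (fun v y hy => ?_) (.congr ?_ fun _ => mem_familyStep.symm)) hf hg
  · have hω : ∀ i ∈ ImpUniverse.omegaSet, i ∈ C :=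
      hC.trans _ (hC.isOrdinal_mem isOrdinal_omegaSet)
    have hF : ∀ R ∈ (v 1 : ZFSet.{u}), R ∈ C := hC.trans _ (v 1).2
    rcases mem_familyStep.1 hy with ⟨i, hi, j, hj, -, rfl⟩ | ⟨i, hi, j, hj, -, -, rfl⟩ |
      ⟨R, hR, S, hS, rfl⟩ | ⟨i, hi, -, R, hR, rfl⟩
    · exact (DfnFun.atomMem hC (.var (0 : Fin 3)) (.var 1) (.var 2)).mem
        ![v 0, ⟨i, hω i hi⟩, ⟨j, hω j hj⟩]
    · exact (DfnFun.atomEq hC (.var (0 : Fin 3)) (.var 1) (.var 2)).mem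
        ![v 0, ⟨i, hω i hi⟩, ⟨j, hω j hj⟩]
    · exact (DfnFun.relImp hC (.var (0 : Fin 3)) (.var 1) (.var 2)).mem
        ![v 0, ⟨R, hF R hR⟩, ⟨S, hF S hS⟩]
    · exact (DfnFun.relEx hC (.var (0 : Fin 3)) (.var 1) (.var 2)).mem
        ![v 0, ⟨i, hω i hi⟩, ⟨R, hF R hR⟩]
  · refine .or (.bex hC (.omegaSet hC) (.bex hC (.omegaSet hC) (.and
      (.not (.eq (.var (some none)) (.empty hC)))
      (.eq (.var (some (some none)))
        (.atomMem hC (.var (some (some (some 0)))) (.var (some none)) (.var none)))))) ?_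
    refine .or (.bex hC (.omegaSet hC) (.bex hC (.omegaSet hC) (.and
      (.not (.eq (.var (some none)) (.empty hC))) (.and (.not (.eq (.var none) (.empty hC)))
      (.eq (.var (some (some none)))
        (.atomEq hC (.var (some (some (some 0)))) (.var (some none)) (.var none))))))) ?_
    refine .or (.bex hC (.var (some 1)) (.bex hC (.var (some (some 1))) (.eq
      (.var (some (some none)))
        (.relImp hC (.var (some (some (some 0)))) (.var (some none)) (.var none))))) ?_
    exact .bex hC (.omegaSet hC) (.and (.not (.eq (.var none) (.empty hC)))
      (.bex hC (.var (some (some 1))) (.eq (.var (some (some none)))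
        (.relEx hC (.var (some (some (some 0)))) (.var (some none)) (.var none)))))

theorem DfnFun.family {f : (ι → C) → ZFSet.{u}} (hf : DfnFun C f) :
    DfnFun C (fun v => family (f v)) :=
  DfnFun.iterate hC (.familyStep hC (.var 0) (.var 1)) hf (.omegaSet hC)

end

end Family

/-! ### The family of definable relations and first-order formulas -/

section Points

variable {C : Set ZFSet.{u}} {M : ZFSet.{u}}

/-- The sequence `k, g 0, g 1, …`. -/
def point (k : ZFSet.{u}) (g : ℕ → (M : Set ZFSet.{u})) : ZFSet.{u} :=
  seqGraph fun n => Nat.casesOn n k fun i => (g i : ZFSet.{u})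

@[simp]
theorem app_point_zero (k : ZFSet.{u}) (g : ℕ → (M : Set ZFSet.{u})) :
    app (point k g) (natSet 0) = k := app_seqGraph _ _

@[simp]
theorem app_point_succ (k : ZFSet.{u}) (g : ℕ → (M : Set ZFSet.{u})) (i : ℕ) :
    app (point k g) (natSet (i + 1)) = g i := app_seqGraph _ _

theorem mem_points_iff_exists_point {K s : ZFSet.{u}} : s ∈ points C M K ↔
    s ∈ C ∧ ∃ k ∈ K, ∃ g : ℕ → (M : Set ZFSet.{u}), s = point k g := by
  rw [mem_points]
  refine and_congr Iff.rfl ⟨?_, ?_⟩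
  · rintro ⟨f, rfl, h0, hs⟩
    refine ⟨f 0, h0, fun i => ⟨f (i + 1), hs i⟩, congrArg seqGraph (funext fun n => ?_)⟩
    cases n <;> rfl
  · rintro ⟨k, hk, g, rfl⟩
    exact ⟨_, rfl, hk, fun i => (g i).2⟩

theorem point_mem_points {K k : ZFSet.{u}} {g : ℕ → (M : Set ZFSet.{u})} (hk : k ∈ K)
    (h : point k g ∈ C) : point k g ∈ points C M K :=
  mem_points_iff_exists_point.2 ⟨h, k, hk, g, rfl⟩

theorem agreeOff_zero_point {k l : ZFSet.{u}} {g h : ℕ → (M : Set ZFSet.{u})} :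
    AgreeOff (natSet 0) (point k g) (point l h) ↔ h = g := by
  constructor
  · intro H
    funext i
    have := H (natSet (i + 1)) (natSet_mem_omegaSet _) (by simp [natSet_injective.eq_iff])
    simp only [app_point_succ] at this
    exact Subtype.ext this.symm
  · rintro rfl j hj hj0
    obtain ⟨n, rfl⟩ := mem_omegaSet.1 hj
    cases n with
    | zero => exact absurd rfl hj0
    | succ n => simp

theorem agreeOff_succ_point {k l : ZFSet.{u}} {g h : ℕ → (M : Set ZFSet.{u})} {i : ℕ} :
    AgreeOff (natSet (i + 1)) (point k g) (point l h) ↔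
      l = k ∧ h = Function.update g i (h i) := by
  constructor
  · intro H
    constructor
    · have := H (natSet 0) (natSet_mem_omegaSet _) (by simp [natSet_injective.eq_iff])
      simpa using this.symm
    · funext j
      by_cases hj : j = i
      · rw [hj, Function.update_self]
      · rw [Function.update_of_ne hj]
        have := H (natSet (j + 1)) (natSet_mem_omegaSet _) (by simpa [natSet_injective.eq_iff])
        simp only [app_point_succ] at this
        exact Subtype.ext this.symm
  · rintro ⟨rfl, H⟩ j hj hji
    obtain ⟨n, rfl⟩ := mem_omegaSet.1 hj
    cases n with
    | zero => simp
    | succ n =>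
      have hn : n ≠ i := fun h => hji (h ▸ rfl)
      rw [app_point_succ, app_point_succ, H, Function.update_of_ne hn]

/-- `C` may lack many ω-sequences, but it is closed under changing one value. This suffices, because
formulas inspect finitely many coordinates and a projection alters one. -/
theorem seqGraph_update_mem (hC : DefinablyClosed C) {f : ℕ → ZFSet.{u}} (hf : seqGraph f ∈ C)
    (n : ℕ) {x : ZFSet.{u}} (hx : x ∈ C) : seqGraph (Function.update f n x) ∈ C := by
  have hn : natSet n ∈ C := hC.isOrdinal_mem (isOrdinal_natSet n)
  have hpair : ∀ a b, a ∈ C → b ∈ C → ZFSet.pair a b ∈ C := fun a b ha hb =>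
    (DfnFun.pair hC (.var (0 : Fin 2)) (.var 1)).mem ![⟨a, ha⟩, ⟨b, hb⟩]
  have hval : ∀ m, f m ∈ C := fun m => by
    rw [← app_seqGraph f m]
    exact (DfnFun.app hC (.var (0 : Fin 2)) (.var 1)).mem
      ![⟨_, hf⟩, ⟨_, hC.isOrdinal_mem (isOrdinal_natSet m)⟩]
  refine hC.mem_of_dfn (ι := Fin 3) (P := fun v p => p = ZFSet.pair (v 1) (v 2) ∨
      ∃ j ∈ omegaSet, j ≠ v 1 ∧ p = ZFSet.pair j (app (v 0) j))
    (.or (.eq (.var _) (.pair hC (.var (some 1)) (.var (some 2))))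
      (.bex hC (.omegaSet hC) (.and (.not (.eq (.var _) (.var (some (some 1)))))
        (.eq (.var _) (.pair hC (.var none) (.app hC (.var (some (some 0))) (.var none)))))))
    ![⟨_, hf⟩, ⟨_, hn⟩, ⟨x, hx⟩] (fun p hp => ?_) (fun p _ => ?_)
  · obtain ⟨m, rfl⟩ := mem_seqGraph.1 hp
    refine hpair _ _ (hC.isOrdinal_mem (isOrdinal_natSet m)) ?_
    by_cases hm : m = n
    · rwa [hm, Function.update_self]
    · rw [Function.update_of_ne hm]
      exact hval m
  · rw [mem_seqGraph]
    constructor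
    · rintro ⟨m, rfl⟩
      by_cases hm : m = n
      · rw [hm, Function.update_self]
        exact .inl rfl
      · rw [Function.update_of_ne hm]
        refine .inr ⟨natSet m, natSet_mem_omegaSet m, natSet_injective.ne hm, ?_⟩
        simp
    · rintro (rfl | ⟨j, hj, hjn, rfl⟩)
      · exact ⟨n, by simp⟩
      · obtain ⟨m, rfl⟩ := mem_omegaSet.1 hj
        have hm : m ≠ n := fun h => hjn (h ▸ rfl)
        exact ⟨m, by simp [Function.update_of_ne hm]⟩

theorem seqGraph_const_mem (hC : DefinablyClosed C) {x : ZFSet.{u}} (hx : x ∈ C) :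
    seqGraph (fun _ => x) ∈ C := by
  refine hC.mem_of_dfn (ι := Fin 1) (P := fun v p => ∃ j ∈ omegaSet, p = ZFSet.pair j (v 0))
    (.bex hC (.omegaSet hC) (.eq (.var _) (.pair hC (.var none) (.var (some (some 0))))))
    ![⟨x, hx⟩] (fun p hp => ?_) (fun p _ => ?_)
  · obtain ⟨m, rfl⟩ := mem_seqGraph.1 hp
    exact (DfnFun.pair hC (.var (0 : Fin 2)) (.var 1)).mem
      ![⟨_, hC.isOrdinal_mem (isOrdinal_natSet m)⟩, ⟨x, hx⟩]
  · rw [mem_seqGraph]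
    constructor
    · rintro ⟨m, rfl⟩
      exact ⟨natSet m, natSet_mem_omegaSet m, rfl⟩
    · rintro ⟨j, hj, rfl⟩
      obtain ⟨m, rfl⟩ := mem_omegaSet.1 hj
      exact ⟨m, rfl⟩

theorem point_update (k : ZFSet.{u}) (g : ℕ → (M : Set ZFSet.{u})) (i : ℕ)
    (x : (M : Set ZFSet.{u})) : point k (Function.update g i x) =
      seqGraph (Function.update (fun n => Nat.casesOn n k fun i => (g i : ZFSet.{u})) (i + 1) x) := by
  refine congrArg seqGraph (funext fun n => ?_)
  cases n with
  | zero => simp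
  | succ n =>
    by_cases hn : n = i
    · simp [hn]
    · simp [hn]

theorem point_update_mem (hC : DefinablyClosed C) (hM : M ∈ C) {k : ZFSet.{u}}
    {g : ℕ → (M : Set ZFSet.{u})} (h : point k g ∈ C) (i : ℕ) (x : (M : Set ZFSet.{u})) :
    point k (Function.update g i x) ∈ C := by
  rw [point_update]
  exact seqGraph_update_mem hC h _ (hC.trans _ hM _ x.2)

/-- A constant sequence is in `C`; finitely many changes give it the prescribed values. Without an
element of `M` there would be no sequence at all, so `M = ∅` is treated separately throughout. -/
theorem exists_point_mem (hC : DefinablyClosed C) (hM : M ∈ C) {k : ZFSet.{u}} (hk : k ∈ C)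
    (hne : M ≠ ∅) {n : ℕ} (p : Fin n → (M : Set ZFSet.{u})) :
    ∃ g : ℕ → (M : Set ZFSet.{u}), point k g ∈ C ∧ ∀ i : Fin n, g i = p i := by
  obtain ⟨m, hm⟩ : ∃ m, m ∈ M := by
    by_contra h
    exact hne ((ZFSet.eq_empty M).2 (not_exists.1 h))
  induction n with
  | zero =>
    refine ⟨fun _ => ⟨m, hm⟩, ?_, fun i => i.elim0⟩
    convert seqGraph_update_mem hC (seqGraph_const_mem hC (hC.trans _ hM _ hm)) 0 hk using 1
    refine congrArg seqGraph (funext fun n => ?_)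
    cases n <;> simp
  | succ n ih =>
    obtain ⟨g, hg, hgp⟩ := ih fun i => p i.castSucc
    refine ⟨Function.update g n (p (Fin.last n)), point_update_mem hC hM hg _ _, fun i => ?_⟩
    refine Fin.lastCases ?_ (fun i => ?_) i
    · simp
    · rw [← hgp i, Fin.val_castSucc, Function.update_of_ne (by have := i.2; omega)]

/-- The relation `R` on the set `points C M K` corresponds to the predicate `Q`. -/
def Represents (C : Set ZFSet.{u}) (K R : ZFSet.{u})
    (Q : ZFSet.{u} → (ℕ → (M : Set ZFSet.{u})) → Prop) : Prop :=
  ∀ k ∈ K, ∀ g : ℕ → (M : Set ZFSet.{u}), point k g ∈ C → (point k g ∈ R ↔ Q k g)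

variable {K R S : ZFSet.{u}} {Q Q' : ZFSet.{u} → (ℕ → (M : Set ZFSet.{u})) → Prop}

theorem represents_atomMem_zero (i : ℕ) :
    Represents C K (atomMem (points C M K) (natSet (i + 1)) (natSet 0))
      (fun k (g : ℕ → (M : Set ZFSet.{u})) => (g i : ZFSet.{u}) ∈ k) := fun k hk g hg => by
  simp [atomMem, ZFSet.mem_sep, point_mem_points hk hg]

theorem represents_atomMem_succ (i j : ℕ) :
    Represents C K (atomMem (points C M K) (natSet (i + 1)) (natSet (j + 1)))
      (fun _ (g : ℕ → (M : Set ZFSet.{u})) => (g i : ZFSet.{u}) ∈ (g j : ZFSet.{u})) :=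
  fun k hk g hg => by simp [atomMem, ZFSet.mem_sep, point_mem_points hk hg]

theorem represents_atomEq (i j : ℕ) :
    Represents C K (atomEq (points C M K) (natSet (i + 1)) (natSet (j + 1)))
      (fun _ (g : ℕ → (M : Set ZFSet.{u})) => g i = g j) :=
  fun k hk g hg => by
    rw [atomEq, ZFSet.mem_sep, and_iff_right (point_mem_points hk hg), app_point_succ,
      app_point_succ]
    exact Subtype.ext_iff.symm

theorem Represents.relImp (hR : Represents C K R Q) (hS : Represents C K S Q') :
    Represents C K (relImp (points C M K) R S) (fun k g => Q k g → Q' k g) :=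
  fun k hk g hg => by
    simp [ImpUniverse.relImp, ZFSet.mem_sep, point_mem_points hk hg, hR k hk g hg, hS k hk g hg]

/-- Projection among the sequences of `C` is a true existential quantifier over `M`, since changing
one coordinate stays in `C`. -/
theorem Represents.relEx (hC : DefinablyClosed C) (hM : M ∈ C) (hR : Represents C K R Q)
    (hsub : R ⊆ points C M K) (i : ℕ) :
    Represents C K (relEx (points C M K) (natSet (i + 1)) R)
      (fun k g => ∃ x, Q k (Function.update g i x)) := fun k hk g hg => by
  rw [ImpUniverse.relEx, ZFSet.mem_sep, and_iff_right (point_mem_points hk hg)]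
  constructor
  · rintro ⟨t, ht, h⟩
    obtain ⟨htC, l, _, g', rfl⟩ := mem_points_iff_exists_point.1 (hsub ht)
    obtain ⟨rfl, hg'⟩ := agreeOff_succ_point.1 h
    refine ⟨g' i, ?_⟩
    rw [← hg']
    exact (hR l hk g' htC).1 ht
  · rintro ⟨x, hx⟩
    refine ⟨point k (Function.update g i x),
      (hR k hk _ (point_update_mem hC hM hg i x)).2 hx, agreeOff_succ_point.2 ⟨rfl, by simp⟩⟩

/-- The passage from relations back to formulas. The class `𝒬` is left open so that it can be
definability over `⟨M, ∈⟩` in one use and uniform definability over all expansions in the other. -/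
theorem exists_represents_of_mem_family (hC : DefinablyClosed C) (hM : M ∈ C)
    {𝒬 : (ZFSet.{u} → (ℕ → (M : Set ZFSet.{u})) → Prop) → Prop}
    (hpred : ∀ i, 𝒬 fun k g => (g i : ZFSet.{u}) ∈ k)
    (hmem : ∀ i j, 𝒬 fun _ g => (g i : ZFSet.{u}) ∈ (g j : ZFSet.{u}))
    (heq : ∀ i j, 𝒬 fun _ g => g i = g j)
    (himp : ∀ Q Q', 𝒬 Q → 𝒬 Q' → 𝒬 fun k g => Q k g → Q' k g)
    (hex : ∀ i Q, 𝒬 Q → 𝒬 fun k g => ∃ x, Q k (Function.update g i x))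
    (hR : R ∈ family (points C M K)) : ∃ Q, 𝒬 Q ∧ Represents C K R Q := by
  refine (family_induction (p := fun R => R ⊆ points C M K ∧ ∃ Q, 𝒬 Q ∧ Represents C K R Q)
    ?_ ?_ ?_ ?_ hR).2
  · rintro i (_ | j)
    · exact ⟨ZFSet.sep_subset, _, hpred i, represents_atomMem_zero i⟩
    · exact ⟨ZFSet.sep_subset, _, hmem i j, represents_atomMem_succ i j⟩
  · exact fun i j => ⟨ZFSet.sep_subset, _, heq i j, represents_atomEq i j⟩
  · rintro R S ⟨-, Q, hQ, hRQ⟩ ⟨-, Q', hQ', hSQ⟩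
    exact ⟨ZFSet.sep_subset, _, himp Q Q' hQ hQ', hRQ.relImp hSQ⟩
  · rintro i R ⟨hsub, Q, hQ, hRQ⟩
    exact ⟨ZFSet.sep_subset, _, hex i Q hQ, hRQ.relEx hC hM hsub i⟩

/-- Some relation in the family corresponds to the predicate `Q`. -/
def Representable (C : Set ZFSet.{u}) (K : ZFSet.{u})
    (Q : ZFSet.{u} → (ℕ → (M : Set ZFSet.{u})) → Prop) : Prop :=
  ∃ R ∈ family (points C M K), Represents C K R Q

theorem representable_falsum :
    Representable C K (fun _ (_ : ℕ → (M : Set ZFSet.{u})) => False) :=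
  -- Falsity is represented by the relation `g 0 ∈ g 0`, empty by foundation; natural number 1 is
  -- the position of `g 0`.
  ⟨_, atomMem_mem_family _ 0 1, fun k hk g hg =>
    (represents_atomMem_succ 0 0 k hk g hg).trans (iff_false_intro (ZFSet.mem_irrefl _))⟩

theorem Representable.imp (hQ : Representable C K Q) (hQ' : Representable C K Q') :
    Representable C K (fun k g => Q k g → Q' k g) :=
  let ⟨_, hR, h⟩ := hQ
  let ⟨_, hR', h'⟩ := hQ'
  ⟨_, relImp_mem_family hR hR', h.relImp h'⟩

theorem Representable.all (hC : DefinablyClosed C) (hM : M ∈ C) (hQ : Representable C K Q)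
    (i : ℕ) : Representable C K (fun k g => ∀ x, Q k (Function.update g i x)) := by
  obtain ⟨R, hR, h⟩ := hQ.imp representable_falsum
  obtain ⟨S, hS, h'⟩ := Representable.imp
    ⟨_, relEx_mem_family i hR, h.relEx hC hM (subset_of_mem_family hR) i⟩ representable_falsum
  exact ⟨S, hS, fun k hk g hg => (h' k hk g hg).trans (by simp)⟩

end Points

/-! ### Induction on formulas whose variables are numbered by `ℕ` -/

section Formulas

variable {L : FirstOrder.Language.{0, 0}} {X T : Type*}

/-- The `n` free variables occupy coordinates below `n`, and the bound variable `j` occupies `n +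
j`; quantifying then means updating one coordinate of a single assignment. -/
theorem boundedFormula_realize_induction [∀ n, IsEmpty (L.Functions n)] (str : T → L.Structure X)
    {𝒬 : (T → (ℕ → X) → Prop) → Prop} (hfalsum : 𝒬 fun _ _ => False)
    (heq : ∀ i j, 𝒬 fun _ g => g i = g j)
    (hrel : ∀ (l : ℕ) (r : L.Relations l) (e : Fin l → ℕ),
      𝒬 fun t g => (letI := str t; Structure.RelMap r fun a => g (e a)))
    (himp : ∀ Q Q', 𝒬 Q → 𝒬 Q' → 𝒬 fun t g => Q t g → Q' t g)
    (hall : ∀ i Q, 𝒬 Q → 𝒬 fun t g => ∀ x, Q t (Function.update g i x))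
    {n m : ℕ} (φ : L.BoundedFormula (Fin n) m) :
    𝒬 fun t g => (letI := str t; φ.Realize (fun i => g i) (fun j => g (n + j))) := by
  have hterm : ∀ {m : ℕ} (s : L.Term (Fin n ⊕ Fin m)), ∃ i : ℕ, ∀ t (g : ℕ → X),
      (letI := str t; s.realize (Sum.elim (fun i : Fin n => g i) fun j : Fin m => g (n + j))) = g i := by
    intro m s
    match s with
    | .var (.inl i) => exact ⟨i, fun _ _ => rfl⟩
    | .var (.inr j) => exact ⟨n + j, fun _ _ => rfl⟩
    | .func f _ => exact isEmptyElim f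
  induction φ with
  | falsum => exact hfalsum
  | equal s₁ s₂ =>
    obtain ⟨i, hi⟩ := hterm s₁
    obtain ⟨j, hj⟩ := hterm s₂
    convert heq i j using 3 with t g
    rw [← hi t g, ← hj t g]
    rfl
  | rel r ss =>
    choose e he using fun a => hterm (ss a)
    convert hrel _ r e using 3 with t g
    simp only [← he _ t g]
    rfl
  | imp φ ψ ihφ ihψ => exact himp _ _ ihφ ihψ
  | @all m φ ih =>
    convert hall (n + m) _ ih using 3 with t g
    let := str t
    refine BoundedFormula.realize_all.trans (forall_congr' fun x => ?_)
    rw [iff_eq_eq]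
    congr 1
    · funext i
      rw [Function.update_of_ne (by have := i.2; omega)]
    · funext j
      refine Fin.lastCases ?_ (fun j => ?_) j
      · simp
      · rw [Fin.snoc_castSucc, Fin.val_castSucc,
          Function.update_of_ne (by have := j.2; omega)]

theorem UniformlyDefinable.ex_update {str : T → L.Structure X} {Q : T → (ℕ → X) → Prop}
    (hQ : UniformlyDefinable L str Q) (i : ℕ) :
    UniformlyDefinable L str (fun t g => ∃ x, Q t (Function.update g i x)) :=
  UniformlyDefinable.ex ((hQ.relabel fun j => if j = i then none else some j).congr fun t w => by
    rw [iff_eq_eq]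
    congr 1
    funext j
    by_cases hj : j = i
    · rw [hj, if_pos rfl, Function.update_self]
    · rw [if_neg hj, Function.update_of_ne hj])

theorem exists_formula_fin {ι : Type*} (φ : L.Formula ι) (g : ι → X) :
    ∃ (n : ℕ) (ψ : L.Formula (Fin n)) (p : Fin n → X),
      ∀ _ : L.Structure X, ψ.Realize p ↔ φ.Realize g := by
  classical
  let e := φ.freeVarFinset.equivFin
  exact ⟨_, BoundedFormula.restrictFreeVar φ e, fun i => g (e.symm i), fun _ =>
    BoundedFormula.realize_restrictFreeVar g (by simp)⟩

theorem exists_formula_fin_succ_of_definable₁ [L.Structure X] {A : Set X}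
    (h : Set.univ.Definable₁ L A) : ∃ (n : ℕ) (φ : L.Formula (Fin (n + 1))) (p : Fin n → X),
      ∀ x, x ∈ A ↔ φ.Realize (Fin.cons (α := fun _ => X) x p) := by
  obtain ⟨A₀, -, h⟩ := Set.definable_iff_finitely_definable.1 h
  obtain ⟨φ, hφ⟩ := Set.definable_iff_exists_formula_sum.1 h
  let e := A₀.equivFin
  refine ⟨_, φ.relabel (Sum.elim (fun a => (e a).succ) fun _ => 0), fun i => (e.symm i).1,
    fun x => ?_⟩
  rw [Formula.realize_relabel]
  have := Set.ext_iff.1 hφ (fun _ => x)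
  refine Iff.trans this ?_
  rw [Set.mem_ofPred_eq, iff_eq_eq]
  congr 1
  funext i
  cases i <;> simp

end Formulas

/-! ### Definability of the two power set operations -/

section PowerSets

instance isEmpty_functions_setLang (n : ℕ) : IsEmpty (setLang.Functions n) :=
  inferInstanceAs (IsEmpty Empty)

instance isEmpty_functions_setPredLang (n : ℕ) : IsEmpty (setPredLang.Functions n) :=
  inferInstanceAs (IsEmpty (Empty ⊕ Empty))

/-- The predicate symbol, in the expanded language. -/
def predSym : setPredLang.Relations 1 := Sum.inr PredRel.pred

theorem uniformlyDefinable_pred {S : Set ZFSet.{u}} {ι : Type*} (i : ι) :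
    UniformlyDefinable setPredLang (fun B : Set S => expansion S B) (fun B v => v i ∈ B) :=
  ⟨predSym.formula₁ (Term.var i), fun B v => by
    let := expansion S B
    rw [Formula.realize_rel₁]
    rfl⟩

theorem uniformlyDefinable_lift {S : Set ZFSet.{u}} {ι : Type*} (φ : setLang.Formula ι) :
    UniformlyDefinable setPredLang (fun B : Set S => expansion S B) (fun _ v => φ.Realize v) :=
  ⟨LHom.sumInl.onFormula φ, fun B v => by
    let := predStructure B
    exact LHom.realize_onFormula _ φ⟩

theorem uniformlyDefinable_mem {S : Set ZFSet.{u}} {ι : Type*} (i j : ι) :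
    UniformlyDefinable setPredLang (fun B : Set S => expansion S B)
      (fun _ v => (v i : ZFSet.{u}) ∈ (v j : ZFSet.{u})) :=
  (uniformlyDefinable_lift (memSym.formula₂ (Term.var i) (Term.var j))).congr fun _ v => by
    rw [Formula.realize_rel₂]
    rfl

theorem UniformlyDefinable.comp_structure {L : FirstOrder.Language.{0, 0}} {X T T' ι : Type*}
    {str : T → L.Structure X} {P : T → (ι → X) → Prop} (h : UniformlyDefinable L str P)
    (f : T' → T) : UniformlyDefinable L (fun t => str (f t)) (fun t => P (f t)) :=
  let ⟨φ, hφ⟩ := h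
  ⟨φ, fun t => hφ (f t)⟩

/-- If `φ` defines `A`, then `A` is the only `B` satisfying `∀ x, x ∈ B ↔ φ(x)`. -/
theorem defPowerset_subset_impPowerset (M : ZFSet.{u}) : defPowerset M ⊆ impPowerset M := by
  intro A hA
  obtain ⟨hAM, hA⟩ := ZFSet.mem_sep.1 hA
  refine ZFSet.mem_sep.2 ⟨hAM, ?_⟩
  obtain ⟨n, φ, p, hφ⟩ := exists_formula_fin_succ_of_definable₁ hA
  obtain ⟨ψ, hψ⟩ := UniformlyDefinable.all (ι := Fin n)
    (P := fun (B : Set (M : Set ZFSet.{u})) v x => x ∈ B ↔ φ.Realize (Fin.cons x v))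
    ((uniformlyDefinable_pred none).iff (((uniformlyDefinable_lift φ).relabel
      (Fin.cons (α := fun _ => Option (Fin n)) none some)).congr fun _ w => by
        rw [iff_eq_eq]
        congr 1
        funext i
        refine Fin.cases ?_ (fun i => ?_) i <;> simp))
  refine ⟨n, ψ, p, fun B => (hψ B p).trans ?_⟩
  rw [Set.ext_iff]
  exact forall_congr' fun x => by rw [hφ x]

theorem exists_trace_eq {M : ZFSet.{u}} (B : Set (M : Set ZFSet.{u})) :
    ∃ b ⊆ M, trace M b = B := by
  refine ⟨ZFSet.sep (fun x => ∃ h : x ∈ M, ⟨x, h⟩ ∈ B) M, ZFSet.sep_subset, ?_⟩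
  ext x
  simp [trace]

theorem trace_injOn {M A B : ZFSet.{u}} (hA : A ⊆ M) (hB : B ⊆ M) :
    trace M A = trace M B ↔ A = B := by
  refine ⟨fun h => ZFSet.ext fun x => ⟨fun hx => ?_, fun hx => ?_⟩, fun h => h ▸ rfl⟩
  · exact (Set.ext_iff.1 h ⟨x, hA hx⟩).1 hx
  · exact (Set.ext_iff.1 h ⟨x, hB hx⟩).2 hx

theorem mem_defPowerset_empty {A : ZFSet.{u}} : A ∈ defPowerset ∅ ↔ A = ∅ := by
  rw [defPowerset, ZFSet.mem_sep, ZFSet.mem_powerset]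
  constructor
  · exact fun h => (ZFSet.eq_empty A).2 fun x hx => ZFSet.notMem_empty x (h.1 hx)
  · rintro rfl
    refine ⟨ZFSet.empty_subset _, ?_⟩
    unfold Set.Definable₁
    convert Set.definable_empty (L := setLang) (A := Set.univ) using 1
    ext x
    exact absurd (x 0).2 (ZFSet.notMem_empty _)

theorem mem_impPowerset_empty {A : ZFSet.{u}} : A ∈ impPowerset ∅ ↔ A = ∅ := by
  refine ⟨fun h => ?_, fun h => defPowerset_subset_impPowerset _ (mem_defPowerset_empty.2 h)⟩
  exact (ZFSet.eq_empty A).2 fun x hx =>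
    ZFSet.notMem_empty x (ZFSet.mem_powerset.1 (ZFSet.mem_sep.1 h).1 hx)

variable {C : Set ZFSet.{u}} {M K R : ZFSet.{u}}

theorem Represents.exists_agreeOff_one (hC : DefinablyClosed C) (hM : M ∈ C)
    {Q : ZFSet.{u} → (ℕ → (M : Set ZFSet.{u})) → Prop} (hR : R ∈ family (points C M K))
    (h : Represents C K R Q) {k : ZFSet.{u}} (hk : k ∈ K) {g : ℕ → (M : Set ZFSet.{u})}
    (hg : point k g ∈ C) (x : (M : Set ZFSet.{u})) :
    (∃ t ∈ R, app t (natSet 1) = x ∧ AgreeOff (natSet 1) (point k g) t) ↔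
      Q k (Function.update g 0 x) := by
  constructor
  · rintro ⟨t, ht, hx, hag⟩
    obtain ⟨htC, l, _, g', rfl⟩ := mem_points_iff_exists_point.1 (subset_of_mem_family hR ht)
    obtain ⟨rfl, hg'⟩ := agreeOff_succ_point.1 hag
    rw [app_point_succ] at hx
    rw [← Subtype.ext hx, ← hg']
    exact (h l hk g' htC).1 ht
  · intro hQ
    exact ⟨_, (h k hk _ (point_update_mem hC hM hg 0 x)).2 hQ, by simp,
      agreeOff_succ_point.2 ⟨rfl, by simp⟩⟩

/-- Varying coordinate 0 amounts to varying the interpretation of the predicate with the parameters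
fixed; the original entry `k` plays no role. -/
theorem Represents.exists_agreeOff_zero
    {Q : ZFSet.{u} → (ℕ → (M : Set ZFSet.{u})) → Prop} (hR : R ∈ family (points Set.univ M K))
    (h : Represents Set.univ K R Q) (k : ZFSet.{u}) {l : ZFSet.{u}} (hl : l ∈ K)
    (g : ℕ → (M : Set ZFSet.{u})) :
    (∃ t ∈ R, app t (natSet 0) = l ∧ AgreeOff (natSet 0) (point k g) t) ↔ Q l g := by
  constructor
  · rintro ⟨t, ht, hx, hag⟩
    obtain ⟨-, l', _, g', rfl⟩ := mem_points_iff_exists_point.1 (subset_of_mem_family hR ht)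
    obtain rfl := agreeOff_zero_point.1 hag
    rw [app_point_zero] at hx
    subst hx
    exact (h l' hl g' trivial).1 ht
  · intro hQ
    exact ⟨_, (h l hl g trivial).2 hQ, app_point_zero _ _, agreeOff_zero_point.2 rfl⟩

theorem representable_realize_setLang (hC : DefinablyClosed C) (hM : M ∈ C) {n m : ℕ}
    (φ : setLang.BoundedFormula (Fin n) m) :
    Representable C K (fun _ (g : ℕ → (M : Set ZFSet.{u})) =>
      φ.Realize (fun i => g i) (fun j => g (n + j))) := by
  refine boundedFormula_realize_induction
    (fun _ : ZFSet.{u} => memStructure (M : Set ZFSet.{u})) (𝒬 := Representable C K)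
    representable_falsum (fun i j => ⟨_, atomEq_mem_family _ i j, represents_atomEq i j⟩)
    (fun l r e => ?_) (fun _ _ => .imp) (fun i _ hQ => hQ.all hC hM i) φ
  cases r
  exact ⟨_, atomMem_mem_family _ (e 0) (e 1 + 1), represents_atomMem_succ _ _⟩

theorem representable_realize_setPredLang (hC : DefinablyClosed C) (hM : M ∈ C) {n m : ℕ}
    (φ : setPredLang.BoundedFormula (Fin n) m) :
    Representable C K (fun k (g : ℕ → (M : Set ZFSet.{u})) =>
      letI := expansion M (trace M k)
      φ.Realize (fun i => g i) (fun j => g (n + j))) := by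
  refine boundedFormula_realize_induction
    (fun k : ZFSet.{u} => expansion (M : Set ZFSet.{u}) (trace M k)) (𝒬 := Representable C K)
    representable_falsum (fun i j => ⟨_, atomEq_mem_family _ i j, represents_atomEq i j⟩)
    (fun l r e => ?_) (fun _ _ => .imp) (fun i _ hQ => hQ.all hC hM i) φ
  rcases r with r | r
  · cases r
    exact ⟨_, atomMem_mem_family _ (e 0) (e 1 + 1), represents_atomMem_succ _ _⟩
  · cases r
    exact ⟨_, atomMem_mem_family _ (e 0) 0, represents_atomMem_zero _⟩

/-- Definable sets are the sections, along coordinate 1, of relations in the family. With `K = {∅}`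
the predicate coordinate is a dummy. The left side does not mention `C`, so this gives absoluteness
of `P_def`. -/
theorem mem_defPowerset_iff (hC : DefinablyClosed C) (hM : M ∈ C) (hne : M ≠ ∅) {A : ZFSet.{u}} :
    A ∈ defPowerset M ↔ A ⊆ M ∧ ∃ R ∈ family (points C M {∅}), ∃ s ∈ points C M {∅},
      ∀ x ∈ M, x ∈ A ↔ ∃ t ∈ R, app t (natSet 1) = x ∧ AgreeOff (natSet 1) s t := by
  rw [defPowerset, ZFSet.mem_sep, ZFSet.mem_powerset]
  refine and_congr Iff.rfl ⟨fun h => ?_, ?_⟩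
  · obtain ⟨n, φ, p, hφ⟩ := exists_formula_fin_succ_of_definable₁ h
    obtain ⟨R, hR, hRep⟩ := representable_realize_setLang (K := {∅}) hC hM φ
    have h0 : (∅ : ZFSet.{u}) ∈ C := hC.isOrdinal_mem ZFSet.isOrdinal_empty
    obtain ⟨m, hm⟩ : ∃ m, m ∈ M := by
      by_contra h
      exact hne ((ZFSet.eq_empty M).2 (not_exists.1 h))
    obtain ⟨g, hg, hgp⟩ := exists_point_mem hC hM h0 hne
      (Fin.cons (α := fun _ => (M : Set ZFSet.{u})) ⟨m, hm⟩ p)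
    have h0' : (∅ : ZFSet.{u}) ∈ ({∅} : ZFSet.{u}) := ZFSet.mem_singleton.2 rfl
    refine ⟨R, hR, point ∅ g, point_mem_points h0' hg, fun x hx => ?_⟩
    rw [hRep.exists_agreeOff_one hC hM hR h0' hg ⟨x, hx⟩]
    refine (hφ ⟨x, hx⟩).trans ?_
    rw [Formula.Realize, iff_eq_eq]
    congr 1
    · funext i
      refine Fin.cases ?_ (fun i => ?_) i
      · simp
      · have := hgp i.succ
        simp only [Fin.cons_succ] at this
        rw [Fin.cons_succ, Function.update_of_ne (by simp), this]
    · exact Subsingleton.elim _ _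
  · rintro ⟨R, hR, s, hs, hA⟩
    obtain ⟨hsC, k, hk, g, rfl⟩ := mem_points_iff_exists_point.1 hs
    obtain rfl := ZFSet.mem_singleton.1 hk
    obtain ⟨Q, ⟨φ, hφ⟩, hRep⟩ := exists_represents_of_mem_family hC hM
      (𝒬 := fun Q => Dfn (M : Set ZFSet.{u}) (Q ∅))
      -- With predicate value `∅` the predicate atom is false, hence definable as `v i ≠ v i`.
      (fun i => (Dfn.eq_var i i).not.congr fun v => by simp)
      (fun i j => .mem_var i j)
      (fun i j => (Dfn.eq_var i j).congr fun v => Subtype.ext_iff.symm)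
      (fun _ _ => .imp)
      (fun i _ hQ => dfn_iff_uniformlyDefinable.2
        ((dfn_iff_uniformlyDefinable.1 hQ).ex_update i)) hR
    have hdfn : Dfn (M : Set ZFSet.{u}) (fun w : Option ℕ → (M : Set ZFSet.{u}) =>
        Q ∅ (Function.update (fun i => w (some i)) 0 (w none))) :=
      ((show Dfn (M : Set ZFSet.{u}) (Q ∅) from ⟨φ, hφ⟩).relabel
        fun j => if j = 0 then none else some j).congr fun w => by
          rw [iff_eq_eq]
          congr 1
          funext j
          by_cases hj : j = 0
          · rw [hj, if_pos rfl, Function.update_self]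
          · rw [if_neg hj, Function.update_of_ne hj]
    convert definable₁_of_dfn (A := Set.univ) (P := fun v x => Q ∅ (Function.update v 0 x))
      hdfn g fun _ => trivial using 1
    ext x
    exact (hA x x.2).trans (hRep.exists_agreeOff_one hC hM hR hk hsC x)

/-- Uniqueness is tested against every subset of `M` in `V`, so `K` is the full power set and the
ambient class is `V`. -/
theorem mem_impPowerset_iff (hne : M ≠ ∅) {A : ZFSet.{u}} :
    A ∈ impPowerset M ↔ A ⊆ M ∧ ∃ R ∈ family (points Set.univ M M.powerset),
      ∃ s ∈ points Set.univ M M.powerset, ∀ B ∈ M.powerset,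
        (∃ t ∈ R, app t (natSet 0) = B ∧ AgreeOff (natSet 0) s t) ↔ B = A := by
  have hC := definablyClosed_univ.{u}
  rw [impPowerset, ZFSet.mem_sep, ZFSet.mem_powerset]
  refine and_congr_right fun hAM => ⟨fun ⟨n, ψ, p, hψ⟩ => ?_, ?_⟩
  · obtain ⟨R, hR, hRep⟩ := representable_realize_setPredLang (M := M) (K := M.powerset) hC trivial ψ
    have h0 : ∅ ∈ M.powerset := ZFSet.mem_powerset.2 (ZFSet.empty_subset M)
    obtain ⟨g, -, hgp⟩ := exists_point_mem (k := ∅) hC trivial trivial hne p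
    refine ⟨R, hR, point ∅ g, point_mem_points h0 trivial, fun B hB => ?_⟩
    rw [hRep.exists_agreeOff_zero hR ∅ hB g, ← trace_injOn (ZFSet.mem_powerset.1 hB) hAM, ← hψ]
    let := expansion (M : Set ZFSet.{u}) (trace M B)
    change BoundedFormula.Realize ψ (fun i => g i) (fun j => g (n + j)) ↔
      BoundedFormula.Realize ψ p default
    rw [iff_eq_eq]
    congr 1
    · exact funext hgp
    · exact Subsingleton.elim _ _
  · rintro ⟨R, hR, s, hs, hA⟩
    obtain ⟨-, k, hk, g, rfl⟩ := mem_points_iff_exists_point.1 hs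
    obtain ⟨Q, ⟨φ, hφ⟩, hRep⟩ := exists_represents_of_mem_family hC trivial
      (𝒬 := fun Q => UniformlyDefinable setPredLang
        (fun k => expansion (M : Set ZFSet.{u}) (trace M k)) Q)
      (fun i => (uniformlyDefinable_pred i).comp_structure (trace M))
      (fun i j => (uniformlyDefinable_mem i j).comp_structure (trace M))
      (fun i j => .eq i j) (fun _ _ => .imp) (fun i _ hQ => hQ.ex_update i) hR
    obtain ⟨n, ψ, p, hψ⟩ := exists_formula_fin φ g
    refine ⟨n, ψ, p, fun B => ?_⟩
    obtain ⟨b, hb, rfl⟩ := exists_trace_eq B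
    rw [trace_injOn hb hAM, ← hA b (ZFSet.mem_powerset.2 hb),
      hRep.exists_agreeOff_zero hR k (ZFSet.mem_powerset.2 hb) g, ← hφ]
    exact hψ _

theorem DfnFun.defPowerset {ι : Type*} (hC : DefinablyClosed C) {f : (ι → C) → ZFSet.{u}}
    (hf : DfnFun C f) : DfnFun C (fun v => defPowerset (f v)) := by
  have hT : ∀ {κ : Type} (i : κ), DfnFun C (fun v : κ → C => ImpUniverse.points C (v i) {∅}) := fun i =>
    .points hC (.var i) (.singleton hC (.empty hC))
  refine DfnFun.comp₁ (.of_mem hC (fun v A hA => ?_) ?_) hf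
  · by_cases hne : (v 0 : ZFSet.{u}) = ∅
    · rw [hne, mem_defPowerset_empty] at hA
      exact hA ▸ hC.isOrdinal_mem ZFSet.isOrdinal_empty
    · obtain ⟨hsub, R, hR, s, hs, h⟩ := (mem_defPowerset_iff hC (v 0).2 hne).1 hA
      have hRC : R ∈ C := hC.trans _ ((DfnFun.family hC (hT (0 : Fin 1))).mem v) _ hR
      have hsC : s ∈ C := (mem_points.1 hs).1
      refine hC.mem_of_dfn (ι := Fin 3) (P := fun w x => x ∈ (w 0 : ZFSet.{u}) ∧
        ∃ t ∈ (w 1 : ZFSet.{u}), ImpUniverse.app t (ImpUniverse.natSet 1) = x ∧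
          AgreeOff (ImpUniverse.natSet 1) (w 2) t)
        (.and (.mem (.var _) (.var _)) (.bex hC (.var (some 1)) (.and
          (.eq (.app hC (.var _) (.natSet hC 1)) (.var _))
          (.agreeOff hC (.natSet hC 1) (.var _) (.var _)))))
        ![v 0, ⟨R, hRC⟩, ⟨s, hsC⟩] (fun x hx => hC.trans _ (v 0).2 _ (hsub hx)) (fun x _ => ?_)
      exact ⟨fun hx => ⟨hsub hx, (h x (hsub hx)).1 hx⟩, fun hx => (h x hx.1).2 hx.2⟩
  · refine (Dfn.or (.and (.eq (.var (some 0)) (.empty hC)) (.eq (.var none) (.empty hC)))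
      (.and (.not (.eq (.var (some 0)) (.empty hC))) (.and (.subset hC (.var none) (.var (some 0)))
        (Dfn.bex (P := fun w R => ∃ s ∈ ImpUniverse.points C (w (some 0)) {∅},
          ∀ x ∈ (w (some 0) : ZFSet.{u}), x ∈ (w none : ZFSet.{u}) ↔
            ∃ t ∈ R, ImpUniverse.app t (ImpUniverse.natSet 1) = x ∧
              AgreeOff (ImpUniverse.natSet 1) s t) hC (.family hC (hT (some 0)))
          (.bex hC (hT (some (some 0))) (.ball hC (.var _) (.iff (.mem (.var _) (.var _))
            (.bex hC (.var _) (.and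
              (.eq (.app hC (.var _) (.natSet hC 1)) (.var _))
              (.agreeOff hC (.natSet hC 1) (.var _) (.var _)))))))))) |>.congr
                fun w => ?_)
    by_cases hne : (w (some 0) : ZFSet.{u}) = ∅
    · simp only [hne, mem_defPowerset_empty, not_true_eq_false, false_and, or_false, true_and]
    · rw [mem_defPowerset_iff hC (w (some 0)).2 hne]
      simp only [hne, false_and, false_or, not_false_eq_true, true_and]

theorem DfnFun.powerset_univ {ι : Type*} {f : (ι → (Set.univ : Set ZFSet.{u})) → ZFSet.{u}}
    (hf : DfnFun Set.univ f) : DfnFun Set.univ (fun v => (f v).powerset) :=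
  DfnFun.comp₁ (.of_mem definablyClosed_univ (fun _ _ _ => trivial)
    ((Dfn.subset definablyClosed_univ (.var none) (.var (some 0))).congr fun _ =>
      ZFSet.mem_powerset.symm)) hf

theorem DfnFun.impPowerset {ι : Type*} {f : (ι → (Set.univ : Set ZFSet.{u})) → ZFSet.{u}}
    (hf : DfnFun Set.univ f) : DfnFun Set.univ (fun v => impPowerset (f v)) := by
  have hC := definablyClosed_univ.{u}
  have hT : ∀ {κ : Type} (i : κ), DfnFun Set.univ
      (fun v : κ → (Set.univ : Set ZFSet.{u}) =>
        ImpUniverse.points Set.univ (v i) (v i : ZFSet.{u}).powerset) :=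
    fun i => .points hC (.var i) (.powerset_univ (.var i))
  refine DfnFun.comp₁ (.of_mem hC (fun _ _ _ => trivial) ?_) hf
  refine (Dfn.or (.and (.eq (.var (some 0)) (.empty hC)) (.eq (.var none) (.empty hC)))
    (.and (.not (.eq (.var (some 0)) (.empty hC))) (.and (.subset hC (.var none) (.var (some 0)))
      (Dfn.bex (P := fun w R => ∃ s ∈ ImpUniverse.points Set.univ (w (some 0))
          (w (some 0) : ZFSet.{u}).powerset,
        ∀ B ∈ (w (some 0) : ZFSet.{u}).powerset,
          (∃ t ∈ R, ImpUniverse.app t (ImpUniverse.natSet 0) = B ∧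
            AgreeOff (ImpUniverse.natSet 0) s t) ↔ B = w none) hC (.family hC (hT (some 0)))
        (.bex hC (hT (some (some 0))) (.ball hC (.powerset_univ (.var _)) (.iff
          (.bex hC (.var _) (.and
            (.eq (.app hC (.var _) (.natSet hC 0)) (.var _))
            (.agreeOff hC (.natSet hC 0) (.var _) (.var _))))
            (.eq (.var _) (.var _))))))))).congr fun w => ?_
  by_cases hne : (w (some 0) : ZFSet.{u}) = ∅
  · simp only [hne, mem_impPowerset_empty, not_true_eq_false, false_and, or_false, true_and]
  · rw [mem_impPowerset_iff hne]
    simp only [hne, false_and, false_or, not_false_eq_true, true_and]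

end PowerSets

/-! ### Reflection -/

section Reflection

variable {C : Set ZFSet.{u}} {H : Ordinal.{u} → ZFSet.{u}}

/-- There is only a set of pairs of a formula and a tuple from `H γ`, so the levels of chosen
witnesses have a supremum. -/
theorem exists_witness_bound (hH : ∀ x, x ∈ C ↔ ∃ α, x ∈ H α) (γ : Ordinal.{u}) :
    ∃ δ, γ < δ ∧ ∀ (n : ℕ) (φ : setLang.BoundedFormula Empty (n + 1)) (v : Fin n → C),
      (∀ i, (v i : ZFSet.{u}) ∈ H γ) →
      (∃ a : C, φ.Realize default (Fin.snoc (α := fun _ => C) v a)) →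
      ∃ a : C, ∃ ε ≤ δ, (a : ZFSet.{u}) ∈ H ε ∧
        φ.Realize default (Fin.snoc (α := fun _ => C) v a) := by
  have : Small.{u} {x : C // (x : ZFSet.{u}) ∈ H γ} :=
    small_of_injective (β := H γ) (f := fun x => ⟨x.1.1, x.2⟩) fun x y h =>
      Subtype.ext (Subtype.ext (Subtype.mk.inj h))
  let I := Σ n : ℕ, setLang.BoundedFormula Empty (n + 1) ×
    (Fin n → {x : C // (x : ZFSet.{u}) ∈ H γ})
  have key : ∀ i : I, ∃ ε, (∃ a : C, i.2.1.Realize default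
      (Fin.snoc (α := fun _ => C) (fun j => (i.2.2 j).1) a)) →
      ∃ a : C, (a : ZFSet.{u}) ∈ H ε ∧ i.2.1.Realize default
        (Fin.snoc (α := fun _ => C) (fun j => (i.2.2 j).1) a) := by
    intro i
    by_cases h : ∃ a : C, i.2.1.Realize default
      (Fin.snoc (α := fun _ => C) (fun j => (i.2.2 j).1) a)
    · obtain ⟨a, ha⟩ := h
      obtain ⟨ε, hε⟩ := (hH a).1 a.2
      exact ⟨ε, fun _ => ⟨a, hε, ha⟩⟩
    · exact ⟨0, fun h' => absurd h' h⟩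
  choose ε hε using key
  -- The successor of `γ` forces strict growth, so that iterating the bound leads to a limit
  -- ordinal.
  refine ⟨max (Order.succ γ) (⨆ i, ε i), lt_max_of_lt_left (Order.lt_succ γ), fun n φ v hv h => ?_⟩
  obtain ⟨a, ha, ha'⟩ := hε ⟨n, φ, fun i => ⟨v i, hv i⟩⟩ h
  exact ⟨a, _, le_max_of_le_right (Ordinal.le_iSup ε _), ha, ha'⟩

theorem exists_bound (hH : ∀ x, x ∈ C ↔ ∃ α, x ∈ H α) (hmono : ∀ α β, α ≤ β → H α ⊆ H β)
    {X : ZFSet.{u}} (hX : ∀ x ∈ X, x ∈ C) : ∃ α, X ⊆ H α := by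
  choose f hf using fun x : X => (hH x).1 (hX x x.2)
  exact ⟨⨆ x, f x, fun x hx => hmono _ _ (Ordinal.le_iSup f ⟨x, hx⟩) (hf ⟨x, hx⟩)⟩

/-- The inclusion of a level of a hierarchy into its union. -/
def levelEmbedding (hH : ∀ x, x ∈ C ↔ ∃ α, x ∈ H α) (β : Ordinal.{u}) :
    (H β : Set ZFSet.{u}) ↪[setLang] C where
  toFun x := ⟨x, (hH x).2 ⟨β, x.2⟩⟩
  inj' _ _ h := Subtype.ext (Subtype.mk.inj h)
  map_fun' f := isEmptyElim f
  map_rel' r _ := by cases r; exact Iff.rfl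

/-- Closing off under witnesses `ω` times, the Tarski–Vaught test holds at the supremum: a finite
tuple from that limit level already lies in some earlier stage, and its witness lies in the next. -/
theorem exists_elementary_level (hH : ∀ x, x ∈ C ↔ ∃ α, x ∈ H α)
    (hmono : ∀ α β, α ≤ β → H α ⊆ H β)
    (hlim : ∀ l, Order.IsSuccLimit l → ∀ x ∈ H l, ∃ α < l, x ∈ H α)
    {X : ZFSet.{u}} (hX : ∀ x ∈ X, x ∈ C) :
    ∃ β, X ⊆ H β ∧ ∃ f : (H β : Set ZFSet.{u}) ↪ₑ[setLang] C, ∀ x, (f x : ZFSet.{u}) = x := by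
  obtain ⟨α₀, hα₀⟩ := exists_bound hH hmono hX
  choose δ hδ hwit using exists_witness_bound hH
  let b : ℕ → Ordinal.{u} := fun n => δ^[n] α₀
  have hb : ∀ n, b n < b (n + 1) := fun n => by
    simp only [b, Function.iterate_succ_apply']
    exact hδ _
  have hbmono : Monotone b := monotone_nat_of_le_succ fun n => (hb n).le
  have hle : ∀ n, b n ≤ ⨆ n, b n := Ordinal.le_iSup b
  have hsl : Order.IsSuccLimit (⨆ n, b n) := by
    refine ⟨?_, Order.isSuccPrelimit_of_succ_lt fun a ha => ?_⟩
    · exact not_isMin_of_lt ((hb 0).trans_le (hle 1))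
    · obtain ⟨n, hn⟩ := (Ordinal.lt_iSup_iff).1 ha
      exact (Order.succ_le_of_lt hn).trans_lt ((hb n).trans_le (hle _))
  refine ⟨⨆ n, b n, fun x hx => hmono _ _ (hle 0) (hα₀ hx),
    (levelEmbedding hH _).toElementaryEmbedding ?_, fun _ => rfl⟩
  intro n φ v a ha
  have hv : ∀ i, ∃ m, (v i : ZFSet.{u}) ∈ H (b m) := fun i => by
    obtain ⟨α, hα, h⟩ := hlim _ hsl _ (v i).2
    obtain ⟨m, hm⟩ := (Ordinal.lt_iSup_iff).1 hα
    exact ⟨m, hmono _ _ hm.le h⟩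
  choose m hm using hv
  obtain ⟨a', ε, hε, ha', hr⟩ := hwit (b (Finset.univ.sup m)) n φ (levelEmbedding hH _ ∘ v)
    (fun i => hmono _ _ (hbmono (Finset.le_sup (Finset.mem_univ i))) (hm i)) ⟨a, ha⟩
  refine ⟨⟨a', hmono _ _ (hε.trans ?_) ha'⟩, hr⟩
  have := hle (Finset.univ.sup m + 1)
  simp only [b, Function.iterate_succ_apply'] at this
  exact this

theorem definable₁_comap {S S' : Set ZFSet.{u}} (f : S ↪ₑ[setLang] S') {A D : Set S'}
    (hD : A.Definable₁ setLang D) (hA : ∀ a ∈ A, a ∈ Set.range f) :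
    (f ⁻¹' A).Definable₁ setLang (f ⁻¹' D) := by
  obtain ⟨φ, hφ⟩ := Set.definable_iff_exists_formula_sum.1 hD
  choose g hg using fun a : A => hA a a.2
  refine Set.definable_iff_exists_formula_sum.2
    ⟨φ.relabel (Sum.map (fun a => ⟨g a, by simp [hg]⟩) id), ?_⟩
  ext x
  have := Set.ext_iff.1 hφ (fun i => f (x i))
  refine Iff.trans this ?_
  rw [Set.mem_ofPred_eq, Set.mem_ofPred_eq, Formula.realize_relabel, ← f.map_formula, iff_eq_eq]
  congr 1
  funext i
  cases i <;> simp [hg]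

/-- A set definable over the union of a hierarchy, with parameters from `A`, is definable over some
level of the hierarchy, with the same parameters. -/
theorem exists_level_definable₁ (hH : ∀ x, x ∈ C ↔ ∃ α, x ∈ H α)
    (hmono : ∀ α β, α ≤ β → H α ⊆ H β)
    (hlim : ∀ l, Order.IsSuccLimit l → ∀ x ∈ H l, ∃ α < l, x ∈ H α)
    {X : ZFSet.{u}} (hX : ∀ x ∈ X, x ∈ C) {A : Set C}
    (h : A.Definable₁ setLang {y : C | (y : ZFSet.{u}) ∈ X}) :
    ∃ β, X ⊆ H β ∧
      {y : (H β : Set ZFSet.{u}) | ∃ a ∈ A, (a : ZFSet.{u}) = y}.Definable₁ setLang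
        (trace (H β) X) := by
  obtain ⟨A₀, hA₀, h⟩ := Set.definable_iff_finitely_definable.1 h
  obtain ⟨β, hβ, f, hf⟩ := exists_elementary_level hH hmono hlim
    (X := X ∪ ZFSet.range fun a : A₀ => (a.1 : ZFSet.{u})) (by
      intro x hx
      rcases ZFSet.mem_union.1 hx with hx | hx
      · exact hX x hx
      · obtain ⟨a, rfl⟩ := ZFSet.mem_range.1 hx
        exact a.1.2)
  refine ⟨β, fun x hx => hβ (ZFSet.mem_union.2 (.inl hx)), ?_⟩
  have key := definable₁_comap f (A := A₀) (D := {y : C | (y : ZFSet.{u}) ∈ X}) h fun a ha =>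
    ⟨⟨a, hβ (ZFSet.mem_union.2 (.inr (ZFSet.mem_range.2 ⟨⟨a, ha⟩, rfl⟩)))⟩, Subtype.ext (hf _)⟩
  have e : f ⁻¹' {y : C | (y : ZFSet.{u}) ∈ X} = trace (H β) X := by
    ext y
    simp [trace, hf]
  rw [e] at key
  exact Set.Definable.mono key fun y hy => ⟨f y, hA₀ hy, hf y⟩

end Reflection

/-! ### The hierarchies -/

section Hierarchy

variable {P : ZFSet.{u} → ZFSet.{u}}

theorem hierarchy_zero : hierarchy P 0 = ∅ := Ordinal.limitRecOn_zero ..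

theorem hierarchy_add_one (α : Ordinal.{u}) :
    hierarchy P (α + 1) = P (hierarchy P α) := Ordinal.limitRecOn_add_one ..

theorem mem_hierarchy_limit {l : Ordinal.{u}} (hl : Order.IsSuccLimit l) {x : ZFSet.{u}} :
    x ∈ hierarchy P l ↔ ∃ α < l, x ∈ hierarchy P α := by
  rw [hierarchy, Ordinal.limitRecOn_limit _ _ _ _ hl, ZFSet.mem_iUnion]
  simp [hierarchy]

theorem iterate_mono {a b : ZFSet.{u}} (h : a ⊆ b) : iterate P a ⊆ iterate P b := fun _ hx =>
  let ⟨c, hc, hx⟩ := mem_iterate.1 hx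
  mem_iterate.2 ⟨c, h hc, hx⟩

theorem isTransitive_iterate (hP : ∀ M, P M ⊆ M.powerset) {a : ZFSet.{u}} (ha : a.IsTransitive) :
    (iterate P a).IsTransitive := fun x hx y hy => by
  obtain ⟨b, hb, hx⟩ := mem_iterate.1 hx
  exact iterate_mono (ha b hb) (ZFSet.mem_powerset.1 (hP _ hx) hy)

/-- Transitive levels are included in their successors, so the union over all earlier steps
collapses to the last one at a successor. The uniform recursion can then replace the case
distinction. -/
theorem hierarchy_eq_iterate (hP : ∀ M, P M ⊆ M.powerset) (hP' : ∀ M, M.IsTransitive → M ⊆ P M)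
    (α : Ordinal.{u}) : hierarchy P α = iterate P α.toZFSet := by
  induction α using Ordinal.limitRecOn with
  | zero =>
    rw [hierarchy_zero]
    ext x
    simp [mem_iterate]
  | add_one α ih =>
    rw [hierarchy_add_one, ih]
    ext x
    rw [mem_iterate, Ordinal.toZFSet_add_one]
    constructor
    · exact fun hx => ⟨_, ZFSet.mem_insert _ _, hx⟩
    · rintro ⟨b, hb, hx⟩
      rcases ZFSet.mem_insert_iff.1 hb with rfl | hb
      · exact hx
      · exact hP' _ (isTransitive_iterate hP (ZFSet.isOrdinal_toZFSet α).isTransitive)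
          (mem_iterate.2 ⟨b, hb, hx⟩)
  | limit l hl ih =>
    ext x
    rw [mem_hierarchy_limit hl, mem_iterate]
    constructor
    · rintro ⟨α, hα, hx⟩
      rw [ih α hα] at hx
      obtain ⟨b, hb, hx⟩ := mem_iterate.1 hx
      exact ⟨b, Ordinal.toZFSet_monotone hα.le hb, hx⟩
    · rintro ⟨b, hb, hx⟩
      obtain ⟨α, hα, rfl⟩ := Ordinal.mem_toZFSet_iff.1 hb
      refine ⟨α + 1, hl.succ_lt hα, ?_⟩
      rwa [hierarchy_add_one, ih α hα]

theorem defPowerset_subset_powerset (M : ZFSet.{u}) : defPowerset M ⊆ M.powerset :=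
  ZFSet.sep_subset

theorem impPowerset_subset_powerset (M : ZFSet.{u}) : impPowerset M ⊆ M.powerset :=
  ZFSet.sep_subset

theorem subset_defPowerset {M : ZFSet.{u}} (hM : M.IsTransitive) : M ⊆ defPowerset M :=
  fun x hx => ZFSet.mem_sep.2 ⟨ZFSet.mem_powerset.2 (hM x hx),
    definable₁_of_dfn (ι := Unit) (A := Set.univ)
      (P := fun v (y : (M : Set ZFSet.{u})) => (y : ZFSet.{u}) ∈ (v () : ZFSet.{u}))
      (.mem_var _ _) (fun _ => ⟨x, hx⟩) fun _ => trivial⟩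

theorem subset_impPowerset {M : ZFSet.{u}} (hM : M.IsTransitive) : M ⊆ impPowerset M :=
  fun _ hx => defPowerset_subset_impPowerset M (subset_defPowerset hM hx)

theorem hierarchy_impPowerset (α : Ordinal.{u}) :
    hierarchy impPowerset α = iterate impPowerset α.toZFSet :=
  hierarchy_eq_iterate impPowerset_subset_powerset (fun _ => subset_impPowerset) α

theorem hierarchy_defPowerset (α : Ordinal.{u}) :
    hierarchy defPowerset α = iterate defPowerset α.toZFSet :=
  hierarchy_eq_iterate defPowerset_subset_powerset (fun _ => subset_defPowerset) α

theorem definablyClosed_Imp : DefinablyClosed Imp.{u} where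
  trans := by
    rintro x ⟨α, hx⟩ y hy
    refine ⟨α, ?_⟩
    rw [hierarchy_impPowerset] at hx ⊢
    exact isTransitive_iterate impPowerset_subset_powerset
      (ZFSet.isOrdinal_toZFSet α).isTransitive x hx hy
  compr := by
    intro X hX h
    obtain ⟨β, hβ, hdef⟩ := exists_level_definable₁ (H := hierarchy impPowerset)
      (fun _ => Iff.rfl)
      (fun α β hαβ => by
        rw [hierarchy_impPowerset, hierarchy_impPowerset]
        exact iterate_mono (Ordinal.toZFSet_monotone hαβ))
      (fun l hl x hx => (mem_hierarchy_limit hl).1 hx) hX h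
    refine ⟨β + 1, ?_⟩
    rw [hierarchy_add_one]
    exact defPowerset_subset_impPowerset _ (ZFSet.mem_sep.2 ⟨ZFSet.mem_powerset.2 hβ,
      Set.Definable.mono hdef (Set.subset_univ _)⟩)

theorem constructible_subset_Imp : constructible.{u} ⊆ Imp := by
  rintro x ⟨α, hx⟩
  rw [hierarchy_defPowerset] at hx
  have hC := definablyClosed_Imp.{u}
  have hα : α.toZFSet ∈ Imp := hC.isOrdinal_mem (ZFSet.isOrdinal_toZFSet α)
  -- The whole level `L_α` is an element of `Imp`; the recursion does not depend on its parameter,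
  -- for which `α` is inserted.
  have := (DfnFun.iterate (G := fun _ M => defPowerset M) hC (.defPowerset hC (.var 1))
    (.var (0 : Fin 1)) (.var 0)).mem ![⟨_, hα⟩]
  exact hC.trans _ this _ hx

end Hierarchy

/-! ### Ordinal definability -/

section OrdinalDefinable

/-- The ordinals as a family of elements of the universe. -/
def ordinalAssignment (α : Ordinal.{u}) : (Set.univ : Set ZFSet.{u}) := ⟨α.toZFSet, trivial⟩

/-- `x` is definable in the universe from ordinal parameters. -/
def DefinableFromOrdinals (x : ZFSet.{u}) : Prop :=
  ∃ f : (Ordinal.{u} → (Set.univ : Set ZFSet.{u})) → ZFSet.{u},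
    DfnFun Set.univ f ∧ f ordinalAssignment = x

/-- Reflection of the defining formula from `V` to some `V_θ` containing `x`. The ordinal parameters
that survive lie in `V_θ`, so they have rank, and therefore value, below `θ`. -/
theorem DefinableFromOrdinals.ordinalDefinable {x : ZFSet.{u}} (hx : DefinableFromOrdinals x) :
    OrdinalDefinable x := by
  obtain ⟨f, hf, rfl⟩ := hx
  have h := definable₁_of_dfn (A := {y : (Set.univ : Set ZFSet.{u}) | (y : ZFSet.{u}).IsOrdinal})
    (P := fun v y => (y : ZFSet.{u}) = f v) hf.graph ordinalAssignment
    fun α => ZFSet.isOrdinal_toZFSet α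
  obtain ⟨θ, hθ, hdef⟩ := exists_level_definable₁ (C := Set.univ) (H := ZFSet.vonNeumann)
    (X := {f ordinalAssignment})
    (fun x => ⟨fun _ => ZFSet.exists_mem_vonNeumann x, fun _ => trivial⟩)
    (fun _ _ => ZFSet.vonNeumann_subset_of_le)
    (fun l hl x hx => ⟨Order.succ x.rank, hl.succ_lt (ZFSet.mem_vonNeumann.1 hx),
      ZFSet.mem_vonNeumann_succ x⟩)
    (fun _ _ => trivial) (by simpa only [ZFSet.mem_singleton] using h)
  have hmem : f ordinalAssignment ∈ ZFSet.vonNeumann θ := hθ (ZFSet.mem_singleton.2 rfl)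
  refine ⟨θ, ⟨_, hmem⟩, rfl, ?_⟩
  have e : trace (ZFSet.vonNeumann θ) {f ordinalAssignment} = {⟨_, hmem⟩} := by
    ext y
    simp [trace, Subtype.ext_iff]
  rw [e] at hdef
  refine Set.Definable.mono hdef ?_
  rintro y ⟨a, ha, hay⟩
  rw [Set.mem_ofPred_eq, hay] at ha
  have hy := ZFSet.mem_vonNeumann.1 y.2
  rw [Set.mem_ofPred_eq, ← ha.toZFSet_rank_eq]
  exact Ordinal.toZFSet_mem_toZFSet_iff.2 hy

/-- Each relation of the family arises from `T` and natural numbers in finitely many definable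
steps. -/
theorem definableFromOrdinals_of_mem_family {T : ZFSet.{u}} (hT : DefinableFromOrdinals T)
    {R : ZFSet.{u}} (hR : R ∈ family T) : DefinableFromOrdinals R := by
  have hC := definablyClosed_univ.{u}
  obtain ⟨fT, hfT, rfl⟩ := hT
  refine family_induction (p := DefinableFromOrdinals) ?_ ?_ ?_ ?_ hR
  · exact fun i j => ⟨_, .atomMem hC hfT (.natSet hC _) (.natSet hC _), rfl⟩
  · exact fun i j => ⟨_, .atomEq hC hfT (.natSet hC _) (.natSet hC _), rfl⟩
  · rintro R S ⟨fR, hfR, rfl⟩ ⟨fS, hfS, rfl⟩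
    exact ⟨_, .relImp hC hfT hfR hfS, rfl⟩
  · rintro i R ⟨fR, hfR, rfl⟩
    exact ⟨_, .relEx hC hfT (.natSet hC _) hfR, rfl⟩

theorem definableFromOrdinals_of_mem_impPowerset {M : ZFSet.{u}} (hM : DefinableFromOrdinals M)
    (hM' : ∀ x ∈ M, DefinableFromOrdinals x) {A : ZFSet.{u}} (hA : A ∈ impPowerset M) :
    DefinableFromOrdinals A := by
  have hC := definablyClosed_univ.{u}
  by_cases hne : M = ∅
  · rw [hne, mem_impPowerset_empty] at hA
    exact ⟨_, .empty hC, hA.symm⟩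
  obtain ⟨hAM, n, ψ, p, hψ⟩ := ZFSet.mem_sep.1 hA
  rw [ZFSet.mem_powerset] at hAM
  obtain ⟨R, hR, hRep⟩ := representable_realize_setPredLang (M := M) (K := M.powerset) hC trivial ψ
  -- The separated set is `{A}`. Only the `n` coordinates of `t` holding parameters are prescribed:
  -- the others do not affect `ψ`, so no entire sequence has to be definable from ordinals.
  have key : A = ZFSet.sUnion (ZFSet.sep (fun B => ∃ t ∈ R, app t (natSet 0) = B ∧
      ∀ i : Fin n, app t (natSet (i + 1)) = p i) M.powerset) := by
    have hreal : ∀ B, B ⊆ M → ∀ g : ℕ → (M : Set ZFSet.{u}), (∀ i : Fin n, g i = p i) →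
        (point B g ∈ R ↔ B = A) := fun B hB g hg => by
      rw [hRep B (ZFSet.mem_powerset.2 hB) g trivial, ← trace_injOn hB hAM, ← hψ]
      let := expansion (M : Set ZFSet.{u}) (trace M B)
      change BoundedFormula.Realize ψ (fun i => g i) (fun j => g (n + j)) ↔
        BoundedFormula.Realize ψ p default
      rw [iff_eq_eq]
      congr 1
      · exact funext hg
      · exact Subsingleton.elim _ _
    have hsep : ZFSet.sep (fun B => ∃ t ∈ R, app t (natSet 0) = B ∧
        ∀ i : Fin n, app t (natSet (i + 1)) = p i) M.powerset = {A} := by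
      ext B
      rw [ZFSet.mem_sep, ZFSet.mem_powerset, ZFSet.mem_singleton]
      constructor
      · rintro ⟨hB, t, ht, rfl, htp⟩
        obtain ⟨-, k, _, g, rfl⟩ := mem_points_iff_exists_point.1 (subset_of_mem_family hR ht)
        simp only [app_point_zero, app_point_succ] at hB htp ⊢
        exact (hreal k hB g fun i => Subtype.ext (htp i)).1 ht
      · rintro rfl
        obtain ⟨g, -, hg⟩ := exists_point_mem (k := B) hC trivial trivial hne p
        refine ⟨hAM, point B g, (hreal B hAM g hg).2 rfl, app_point_zero _ _, fun i => ?_⟩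
        rw [app_point_succ, hg]
    rw [hsep, ZFSet.sUnion_singleton]
  obtain ⟨fM, hfM, rfl⟩ := hM
  obtain ⟨fR, hfR, rfl⟩ := definableFromOrdinals_of_mem_family
    ⟨_, .points hC hfM (.powerset_univ hfM), rfl⟩ hR
  choose fp hfp hp using fun i => hM' (p i) (p i).2
  simp only [← hp] at key
  rw [key]
  exact ⟨fun v => ZFSet.sUnion (ZFSet.sep (fun B => ∃ t ∈ fR v, app t (natSet 0) = B ∧
      ∀ i : Fin n, app t (natSet (i + 1)) = fp i v) (fM v).powerset),
    .sUnion hC (.sep hC (.powerset_univ hfM) (.bex hC (hfR.relabel some) (.and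
      (.eq (.app hC (.var none) (.natSet hC 0)) (.var (some none)))
      (.forall_fin fun i => .eq (.app hC (.var none) (.natSet hC _))
        ((hfp i).relabel fun j => some (some j)))))), rfl⟩

/-- An element first appears in `P_imp` of an earlier level `Imp_β`. That level is definable from
`β`, and its elements, the possible parameters, are covered by induction. -/
theorem definableFromOrdinals_of_mem_iterate (α : Ordinal.{u}) :
    ∀ x ∈ iterate impPowerset α.toZFSet, DefinableFromOrdinals x := by
  induction α using WellFoundedLT.induction with
  | _ α ih =>
  intro x hx
  obtain ⟨b, hb, hx⟩ := mem_iterate.1 hx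
  obtain ⟨β, hβ, rfl⟩ := Ordinal.mem_toZFSet_iff.1 hb
  exact definableFromOrdinals_of_mem_impPowerset
    ⟨_, DfnFun.iterate (G := fun _ M => impPowerset M) definablyClosed_univ (.impPowerset (.var 1))
      (.var β) (.var β), rfl⟩ (ih β hβ) hx

theorem Imp_subset_HOD : Imp.{u} ⊆ HOD := by
  intro x hx
  induction x using ZFSet.inductionOn with
  | _ x ih =>
  refine ZFSet.hereditarily_iff.2 ⟨?_, fun y hy => ih y hy (definablyClosed_Imp.trans x hx y hy)⟩
  obtain ⟨α, hx⟩ := hx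
  rw [hierarchy_impPowerset] at hx
  exact (definableFromOrdinals_of_mem_iterate α x hx).ordinalDefinable

end OrdinalDefinable

/-! ### The implicitly constructible universe is an inner model -/

section InnerModel

/-- The class of all sets and the universe are isomorphic structures. -/
def univEquiv : (Set.univ : Set ZFSet.{u}) ≃[setLang] ZFSet.{u} where
  toEquiv := Equiv.Set.univ _
  map_fun' f := isEmptyElim f
  map_rel' r _ := by cases r; exact Iff.rfl

theorem definable₁_universe_of_dfn {R : ZFSet.{u} → Prop}
    (h : Dfn Set.univ (fun v : Fin 1 → (Set.univ : Set ZFSet.{u}) => R (v 0))) :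
    Set.univ.Definable₁ setLang {x | R x} := by
  obtain ⟨φ, hφ⟩ := h
  refine Set.Definable.mono (A := ∅) (Set.empty_definable_iff.2 ⟨φ, ?_⟩) (Set.empty_subset _)
  ext x
  exact (hφ fun i => ⟨x i, trivial⟩).symm.trans (StrongHomClass.realize_formula univEquiv φ).symm

theorem dfn_mem_Imp :
    Dfn Set.univ (fun v : Fin 1 → (Set.univ : Set ZFSet.{u}) => (v 0 : ZFSet.{u}) ∈ Imp) := by
  have hC := definablyClosed_univ.{u}
  refine (Dfn.ex (P := fun v a => a.IsOrdinal ∧ (v 0 : ZFSet.{u}) ∈ iterate impPowerset a)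
    (.and (.isOrdinal hC (.var none)) (.mem (.var (some 0))
      (DfnFun.iterate (G := fun _ M => impPowerset M) hC (.impPowerset (.var 1))
        (.var none) (.var none))))).congr fun v => ?_
  constructor
  · rintro ⟨a, _, ha, h⟩
    refine ⟨a.rank, ?_⟩
    rwa [hierarchy_impPowerset, ha.toZFSet_rank_eq]
  · rintro ⟨α, h⟩
    rw [hierarchy_impPowerset] at h
    exact ⟨_, trivial, ZFSet.isOrdinal_toZFSet α, h⟩

theorem isInnerModelZF_Imp : IsInnerModelZF Imp.{u} where
  definable := definable₁_universe_of_dfn dfn_mem_Imp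
  transitive := definablyClosed_Imp.trans
  ordinals _ := definablyClosed_Imp.isOrdinal_mem
  models := definablyClosed_Imp.models_ZF

end InnerModel

end ImpUniverse

end

theorem theorem3 :
    ImpUniverse.IsInnerModelZF ImpUniverse.Imp.{u} ∧
      ImpUniverse.constructible.{u} ⊆ ImpUniverse.Imp.{u} ∧
      ImpUniverse.Imp.{u} ⊆ ImpUniverse.HOD.{u} :=
  ⟨ImpUniverse.isInnerModelZF_Imp, ImpUniverse.constructible_subset_Imp,
    ImpUniverse.Imp_subset_HOD⟩
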